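/- Let $\mathbb F_q$ be a finite field with $q$ elements, let $d\ge 2$, and let $V$ be a finite-dimensional vector space over $\mathbb F_q$ with a form $\omega$ of one of the following types: a nondegenerate symplectic form, $\dim V=2d$; a nondegenerate quadratic form, with $\dim V=2d+1$, or $\dim V=2d$ and Witt index $d$, or $\dim V=2d+2$ and Witt index $d$; or, when $q=r^2$, a nondegenerate Hermitian form with respect to $a\mapsto a^r$, with $\dim V=2d+1$ or $\dim V=2d$. A subspace is called isotropic if the form vanishes completely on it. Let $X$ be the set of maximal isotropic subspaces of $V$ and $\Omega_j$ the set of isotropic subspaces of dimension $j$. Let $\Gamma$ be the dual polar graph with vertex set $X$, in which two distinct vertices $x,y$ are adjacent iff $\dim(x\cap y)=d-1$, and let $A_i$ be its $i$-th distance matrix ($(A_i)_{xy}=1$ if $d(x,y)=i$, and $0$ otherwise). Equip $\mathbb R^X$ with $\langle f,g\rangle=\sum_{x\in X} f(x)g(x)$. For a subspace $u$ let $\iota(u)\in\mathbb R^X$ be the function with $\iota(u)(x)=1$ if $u\subseteq x$ and $0$ otherwise. Put $\Lambda_j=\operatorname{span}\{\iota(u):u\in\Omega_j\}$, $V_0=\Lambda_0$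 and $V_j=\Lambda_j\cap\Lambda_{j-1}^{\perp}$ for $1\le j\le d$. Let $\pi_j$ be the orthogonal projection of $\mathbb R^X$ onto $V_j$, put $\check u=\pi_j(\iota(u))$ for $u\in\Omega_j$, and let $U^j$ be the matrix with entries $(U^j)_{xy}=\sum_{u\in\Omega_j}\iota(u)(x)\,\iota(u)(y)$. Then $\mathbb R^X=V_0\oplus\dots\oplus V_d$, all $V_j$ are nonzero, each $A_i$ ($0\le i\le d$) acts on each $V_j$ as a scalar $p_i(j)$, and $p_1(0)>p_1(1)>\dots>p_1(d)$. Moreover, for every $0\le j\le d$, with $$\lambda_j=\sum_{l=j}^{d}\binom{l}{j}_{q}\,p_{d-l}(j),$$ where $\binom{l}{j}_q$ is the Gaussian binomial coefficient, the following hold. 1. $U^j=\sum_{l=j}^{d}\binom{l}{j}_q A_{d-l}$; $U^j$ acts on $V_j$ as the scalar $\lambda_j$; and every $\check u$, $u\in\Omega_j$, is a (nonzero) eigenvector of $U^j$ with eigenvalue $\lambda_j$. 2. $\lambda_j>0$, and the family $(\check u)_{u\in\Omega_j}$ is a finite tight frame for $V_j$ with constant $\lambda_j$: for all $f\in V_j$,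 $$\sum_{u\in\Omega_j}|\langle f,\check u\rangle|^2=\lambda_j\|f\|^2\qquad\text{and}\qquad \sum_{u\in\Omega_j}\langle\check u,f\rangle\,\check u=\lambda_j f .$$ -/

import Mathlib

/-- The Gaussian binomial coefficient `[n choose k]_q`, as a real number:
`∏_{t < k} [n - t]_q / [t + 1]_q` with `[m]_q = (q ^ m - 1) / (q - 1)`. -/
noncomputable def gaussBinom (q n k : ℕ) : ℝ :=
  ∏ t ∈ Finset.range k, (((q : ℝ) ^ (n - t) - 1) / ((q : ℝ) - 1)) /
    (((q : ℝ) ^ (t + 1) - 1) / ((q : ℝ) - 1))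

/-- The `i`-th distance (adjacency) matrix of a graph. -/
noncomputable def distMatrix {X : Type*} (G : SimpleGraph X) (i : ℕ) : Matrix X X ℝ :=
  open scoped Classical in Matrix.of fun x y => if G.dist x y = i then 1 else 0

/-- `W 0, …, W d` is the decomposition of `ℝ^X` into the common eigenspaces of the matrices
`A_0, …, A_d` of the graph `G`, ordered so that the eigenvalues of `A_1` strictly decrease, and
`p i j` is the eigenvalue of `A_i` on `W j`. -/
structure IsEigenDecomposition {X : Type*} [Fintype X] [DecidableEq X] (G : SimpleGraph X) (d : ℕ)
    (W : ℕ → Submodule ℝ (EuclideanSpace ℝ X)) (p : ℕ → ℕ → ℝ) : Prop where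
  isInternal : DirectSum.IsInternal fun j : Fin (d + 1) => W j
  ne_bot : ∀ j ≤ d, W j ≠ ⊥
  strictAnti : ∀ j k, j < k → k ≤ d → p 1 k < p 1 j
  apply_eq : ∀ i ≤ d, ∀ j ≤ d, ∀ f ∈ W j, (distMatrix G i).toEuclideanLin f = p i j • f

/-- The finite family `v` is a tight frame with constant `c` for the inner product space `E`. -/
def IsTightFrame {ι E : Type*} [Fintype ι] [NormedAddCommGroup E] [InnerProductSpace ℝ E]
    (v : ι → E) (c : ℝ) : Prop :=
  c ≠ 0 ∧ ∀ f : E, ∑ i, |inner ℝ f (v i)| ^ 2 = c * ‖f‖ ^ 2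

/-- The three kinds of forms on a vector space that give rise to dual polar graphs: bilinear
(used for symplectic forms), quadratic, and sesquilinear (used for Hermitian forms). -/
inductive PolarForm (F V : Type*) [Field F] [AddCommGroup V] [Module F V] where
  | symplectic (B : V →ₗ[F] V →ₗ[F] F)
  | quadratic (Q : QuadraticForm F V)
  | hermitian (σ : F →+* F) (B : V →ₛₗ[σ] V →ₗ[F] F)

namespace PolarForm

section Basic

variable {F V : Type*} [Field F] [AddCommGroup V] [Module F V]

/-- A subspace is isotropic if the form vanishes completely on it. -/
def IsIsotropic (ω : PolarForm F V) (u : Submodule F V) : Prop :=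
  match ω with
  | symplectic B => ∀ x ∈ u, ∀ y ∈ u, B x y = 0
  | quadratic Q => ∀ x ∈ u, Q x = 0
  | hermitian _ B => ∀ x ∈ u, ∀ y ∈ u, B x y = 0

/-- The Witt index of `ω`, i.e. the largest dimension of an isotropic subspace, is `d`. -/
def HasWittIndex (ω : PolarForm F V) (d : ℕ) : Prop :=
  IsGreatest {n : ℕ | ∃ u : Submodule F V, ω.IsIsotropic u ∧ Module.finrank F u = n} d

/-- `(V, ω)` is one of the spaces of the six families of dual polar graphs of diameter `d`:
`C_d(q)` (symplectic, dimension `2d`); `B_d(q)`, `D_d(q)`, `²D_{d+1}(q)` (quadratic, of dimension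
`2d+1`, of dimension `2d` and Witt index `d`, of dimension `2d+2` and Witt index `d`);
`²A_{2d}(r)`, `²A_{2d-1}(r)` (Hermitian over the field with `r²` elements, of dimension `2d+1`,
`2d`). -/
def IsDualPolar (ω : PolarForm F V) (d : ℕ) : Prop :=
  match ω with
  | symplectic B => B.IsAlt ∧ B.Nondegenerate ∧ Module.finrank F V = 2 * d
  | quadratic Q => Q.Nondegenerate ∧
      (Module.finrank F V = 2 * d + 1 ∨
        (Module.finrank F V = 2 * d ∧ (quadratic Q).HasWittIndex d) ∨
        (Module.finrank F V = 2 * d + 2 ∧ (quadratic Q).HasWittIndex d))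
  | hermitian σ B => (∃ r : ℕ, Nat.card F = r ^ 2 ∧ ∀ a, σ a = a ^ r) ∧
      B.IsSymm ∧ B.Nondegenerate ∧
      (Module.finrank F V = 2 * d + 1 ∨ Module.finrank F V = 2 * d)

/-- The vertex set `X`: the maximal isotropic subspaces. -/
def Vertex (ω : PolarForm F V) : Type _ := {x : Submodule F V // Maximal ω.IsIsotropic x}

/-- `Ω_j`: the isotropic subspaces of dimension `j`. -/
def Isotropic (ω : PolarForm F V) (j : ℕ) : Type _ :=
  {u : Submodule F V // ω.IsIsotropic u ∧ Module.finrank F u = j}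

/-- The dual polar graph: `x` and `y` are adjacent if `dim (x ∩ y) = d - 1`. -/
def graph (ω : PolarForm F V) (d : ℕ) : SimpleGraph ω.Vertex where
  Adj x y := x ≠ y ∧ Module.finrank F (x.1 ⊓ y.1 : Submodule F V) + 1 = d
  symm := ⟨fun x y h => ⟨h.1.symm, by rw [inf_comm]; exact h.2⟩⟩
  loopless := ⟨fun _ h => h.1 rfl⟩

end Basic

section Finite

variable {F V : Type*} [Field F] [AddCommGroup V] [Module F V] [Finite V]

noncomputable instance (ω : PolarForm F V) : Fintype ω.Vertex :=
  haveI : Finite ω.Vertex := Subtype.finite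
  Fintype.ofFinite _

noncomputable instance (ω : PolarForm F V) : DecidableEq ω.Vertex := Classical.decEq _

noncomputable instance (ω : PolarForm F V) (j : ℕ) : Fintype (ω.Isotropic j) :=
  haveI : Finite (ω.Isotropic j) := Subtype.finite
  Fintype.ofFinite _

/-- `ι(u) ∈ ℝ^X`, the indicator function of the vertices that contain `u`. -/
noncomputable def iota (ω : PolarForm F V) (u : Submodule F V) : EuclideanSpace ℝ ω.Vertex :=
  open scoped Classical in WithLp.toLp 2 fun x => if u ≤ x.1 then 1 else 0

/-- `Λ_j`, the span of the functions `ι(u)` with `u ∈ Ω_j`. -/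
noncomputable def Lam (ω : PolarForm F V) (j : ℕ) : Submodule ℝ (EuclideanSpace ℝ ω.Vertex) :=
  Submodule.span ℝ (Set.range fun u : ω.Isotropic j => ω.iota u.1)

/-- `V_0 = Λ_0` and `V_j = Λ_j ∩ Λ_{j-1}^⊥` for `j ≥ 1`. -/
noncomputable def eigenV (ω : PolarForm F V) : ℕ → Submodule ℝ (EuclideanSpace ℝ ω.Vertex)
  | 0 => ω.Lam 0
  | j + 1 => ω.Lam (j + 1) ⊓ (ω.Lam j)ᗮ

/-- `ǔ = π_j(ι(u))`, where `π_j` is the orthogonal projection onto `V_j`. -/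
noncomputable def check (ω : PolarForm F V) (j : ℕ) (u : ω.Isotropic j) : ω.eigenV j :=
  (ω.eigenV j).orthogonalProjectionOnto (ω.iota u.1)

/-- The matrix `U^j` with entries `∑_{u ∈ Ω_j} ι(u)(x) ι(u)(y)`. -/
noncomputable def matU (ω : PolarForm F V) (j : ℕ) : Matrix ω.Vertex ω.Vertex ℝ :=
  Matrix.of fun x y => ∑ u : ω.Isotropic j, ω.iota u.1 x * ω.iota u.1 y

end Finite

end PolarForm

/-- `λ_j = ∑_{l=j}^d [l choose j]_q p_{d-l}(j)`. -/
noncomputable def frameConst (q d : ℕ) (p : ℕ → ℕ → ℝ) (j : ℕ) : ℝ :=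
  ∑ l ∈ Finset.Icc j d, gaussBinom q l j * p (d - l) j

/-! All six types of form share one geometry. Maximal isotropic subspaces all have dimension d, each
isotropic subspace of dimension d-1 lies in exactly t+1 of them, and the distance of x and y is d -
dim(x ∩ y). These facts are collected in `PolarForm.IsRegular`; everything spectral uses only them.

Put [m] = (q^m - 1)/(q - 1) and θ_j = t[d-j] - [j]. The number of neighbours of x that contain an
isotropic u depends only on dim u and dim(x ∩ u). Hence A_1 is triangular on indicators: A_1 ι(u) is
θ_j ι(u) plus the sum of ι(w) over the hyperplanes w of u, where j = dim u ≥ 1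
(`IsRegular.adj_iota_succ`). So A_1 preserves the flag Λ_0 ⊆ … ⊆ Λ_d = ℝ^X, and being self-adjoint
it acts on the orthogonal layer V_j as θ_j (`IsRegular.adj_eigenV`). The θ_j strictly decrease.

Double counting gives A_1 U^{j+1} = θ_{j+1} U^{j+1} + [d-j] U^j (`IsRegular.adj_matU_succ`).
Starting from U^d = 1, this recursion makes every U^j a polynomial in A_1, hence a scalar on each
V_i. The distance formula writes U^j as a unitriangular combination of the A_{d-l}, so the A_i are
scalars there too.

That V_j and the vectors ǔ do not vanish amounts to ι(u) ∉ Λ_{j-1} for dim u = j ≥ 1, which follows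
from a support argument (`IsRegular.notMem_Lam_of_pos`).

Finally ⟨f, ǔ⟩ = ⟨f, ι(u)⟩ for f in V_j, so the frame identity is ⟨f, U^j f⟩ = λ_j ‖f‖². Positivity
of λ_j holds because the ι(u) span Λ_j ⊇ V_j. -/

open Module

/-! ### Dimension counts in linear algebra -/

section Dimension

variable {F V : Type*} [Field F] [AddCommGroup V] [Module F V] [FiniteDimensional F V]

theorem finrank_sup_span_singleton_of_notMem {s : Submodule F V} {v : V} (hv : v ∉ s) :
    finrank F (s ⊔ Submodule.span F {v} : Submodule F V) = finrank F s + 1 := by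
  have hv0 : v ≠ 0 := fun h => hv (h ▸ s.zero_mem)
  have h1 : s ⊓ Submodule.span F {v} = ⊥ :=
    ((Submodule.disjoint_span_singleton' hv0).2 hv).eq_bot
  have h2 := Submodule.finrank_sup_add_finrank_inf_eq s (Submodule.span F {v})
  rw [h1, finrank_bot, finrank_span_singleton hv0] at h2
  exact h2

theorem finrank_le_finrank_inf_ker_add {W : Type*} [AddCommGroup W] [Module F W]
    [FiniteDimensional F W] (s : Submodule F V) (f : V →ₗ[F] W) :
    finrank F s ≤ finrank F (s ⊓ f.ker : Submodule F V) + finrank F W := by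
  have h1 := LinearMap.finrank_range_add_finrank_ker (f.domRestrict s)
  have h2 : (s ⊓ f.ker : Submodule F V) = (f.domRestrict s).ker.map s.subtype := by
    rw [LinearMap.ker_domRestrict, Submodule.map_comap_subtype]
  have h3 := Submodule.finrank_le (f.domRestrict s).range
  rw [h2, Submodule.finrank_map_subtype_eq]
  omega

theorem finrank_add_le_finrank_add_inf {a b c : Submodule F V} (ha : a ≤ c) (hb : b ≤ c) :
    finrank F a + finrank F b ≤ finrank F c + finrank F (a ⊓ b : Submodule F V) := by
  rw [← Submodule.finrank_sup_add_finrank_inf_eq a b]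
  exact Nat.add_le_add_right (Submodule.finrank_mono (sup_le ha hb)) _

theorem exists_mem_notMem_of_finrank_lt {a b : Submodule F V} (h : finrank F a < finrank F b) :
    ∃ v ∈ b, v ∉ a := by
  by_contra! hc
  exact absurd (Submodule.finrank_mono hc) (not_le.2 h)

/-- A vector space is not the union of two proper subspaces, here applied to the dual. It later
yields a hyperplane that avoids two given points. -/
theorem exists_linearMap_ne_zero_of_ne_zero {p p' : V} (hp : p ≠ 0) (hp' : p' ≠ 0) :
    ∃ φ : V →ₗ[F] F, φ p ≠ 0 ∧ φ p' ≠ 0 := by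
  have aux : ∀ {p : V}, p ≠ 0 → ∃ φ : Dual F V, φ p ≠ 0 := fun {p} hp => by
    by_contra! h
    exact hp ((forall_dual_apply_eq_zero_iff F p).1 h)
  obtain ⟨φ, hφ⟩ := aux hp
  obtain ⟨ψ, hψ⟩ := aux hp'
  by_cases h1 : φ p' = 0
  · by_cases h2 : ψ p = 0
    · exact ⟨φ + ψ, by simpa [h2] using hφ, by simpa [h1] using hψ⟩
    · exact ⟨ψ, h2, hψ⟩
  · exact ⟨φ, hφ, h1⟩

end Dimension

/-- A reflexive sesquilinear form together with a set of singular vectors, with the properties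
shared by symplectic, quadratic and Hermitian forms. -/
structure PolarSpace (F V : Type*) [Field F] [AddCommGroup V] [Module F V] where
  /-- the twist of the form in its first argument -/
  σ : F →+* F
  /-- the sesquilinear form -/
  B : V →ₛₗ[σ] V →ₗ[F] F
  /-- the predicate of being a singular vector -/
  Singular : V → Prop
  zero : Singular 0
  refl : ∀ x y, B x y = 0 → B y x = 0
  self : ∀ x, Singular x → B x x = 0
  comb : ∀ (a b : F) (x y : V), Singular x → Singular y → B x y = 0 → Singular (a • x + b • y)
  hyperbolic : ∀ v w, Singular v → B v w ≠ 0 → ∃ a : F, Singular (w + a • v)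
  radical : ∀ v, Singular v → (∀ y, B v y = 0) → v = 0

/-! ### Isotropic subspaces and orthogonality -/

namespace PolarSpace

variable {F V : Type*} [Field F] [AddCommGroup V] [Module F V] (P : PolarSpace F V)

/-- Isotropic subspaces of a polar space. -/
def Iso (u : Submodule F V) : Prop :=
  (∀ x ∈ u, P.Singular x) ∧ ∀ x ∈ u, ∀ y ∈ u, P.B x y = 0

/-- The orthogonal subspace. -/
def perp (u : Submodule F V) : Submodule F V where
  carrier := {y | ∀ v ∈ u, P.B v y = 0}
  zero_mem' := fun v _ => map_zero _
  add_mem' := fun {a b} ha hb v hv => by rw [map_add, ha v hv, hb v hv, add_zero]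
  smul_mem' := fun c a ha v hv => by rw [map_smul, ha v hv, smul_zero]

variable {P}

theorem mem_perp {u : Submodule F V} {y : V} : y ∈ P.perp u ↔ ∀ v ∈ u, P.B v y = 0 := Iff.rfl

theorem perp_anti {u w : Submodule F V} (h : u ≤ w) : P.perp w ≤ P.perp u :=
  fun _ hy v hv => hy v (h hv)

theorem mem_perp_span_singleton {v y : V} :
    y ∈ P.perp (Submodule.span F {v}) ↔ P.B v y = 0 := by
  refine ⟨fun h => h v (Submodule.mem_span_singleton_self v), fun h w hw => ?_⟩
  obtain ⟨a, rfl⟩ := Submodule.mem_span_singleton.1 hw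
  simp [h]

theorem perp_sup (u w : Submodule F V) : P.perp (u ⊔ w) = P.perp u ⊓ P.perp w := by
  refine le_antisymm (le_inf (perp_anti le_sup_left) (perp_anti le_sup_right)) ?_
  rintro y ⟨h1, h2⟩ v hv
  obtain ⟨a, ha, b, hb, rfl⟩ := Submodule.mem_sup.1 hv
  simp [h1 a ha, h2 b hb]

theorem Iso.mono {u w : Submodule F V} (hw : P.Iso w) (h : u ≤ w) : P.Iso u :=
  ⟨fun x hx => hw.1 x (h hx), fun x hx y hy => hw.2 x (h hx) y (h hy)⟩

theorem Iso.sup_span {u : Submodule F V} (hu : P.Iso u) {v : V} (hv : P.Singular v)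
    (h : v ∈ P.perp u) : P.Iso (u ⊔ Submodule.span F {v}) := by
  constructor
  · intro x hx
    obtain ⟨a, ha, b, hb, rfl⟩ := Submodule.mem_sup.1 hx
    obtain ⟨c, rfl⟩ := Submodule.mem_span_singleton.1 hb
    simpa using P.comb 1 c a v (hu.1 a ha) hv (h a ha)
  · intro x hx y hy
    obtain ⟨a, ha, b, hb, rfl⟩ := Submodule.mem_sup.1 hx
    obtain ⟨c, rfl⟩ := Submodule.mem_span_singleton.1 hb
    obtain ⟨a', ha', b', hb', rfl⟩ := Submodule.mem_sup.1 hy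
    obtain ⟨c', rfl⟩ := Submodule.mem_span_singleton.1 hb'
    simp [hu.2 a ha a' ha', h a ha, P.refl _ _ (h a' ha'), P.self v hv]

theorem mem_of_maximal {x : Submodule F V} (hx : Maximal P.Iso x) {v : V} (hv : P.Singular v)
    (h : v ∈ P.perp x) : v ∈ x :=
  hx.2 (hx.1.sup_span hv h) le_sup_left
    (Submodule.mem_sup_right (Submodule.mem_span_singleton_self v))

theorem inf_perp_le_of_maximal {x y : Submodule F V} (hx : Maximal P.Iso x) (hy : P.Iso y) :
    y ⊓ P.perp x ≤ x :=
  fun _ hv => mem_of_maximal hx (hy.1 _ hv.1) hv.2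

theorem iso_bot : P.Iso ⊥ :=
  ⟨fun x hx => (Submodule.mem_bot F).1 hx ▸ P.zero, fun x hx y _ => by
    rw [(Submodule.mem_bot F).1 hx, map_zero, LinearMap.zero_apply]⟩

theorem exists_maximal_ge [Finite V] {u : Submodule F V} (hu : P.Iso u) :
    ∃ x, u ≤ x ∧ Maximal P.Iso x :=
  Finite.exists_le_maximal hu

section FiniteDimensional

variable [FiniteDimensional F V]

theorem perp_eq_ker (u : Submodule F V) :
    ∃ f : V →ₗ[F] (Fin (finrank F u) → F), f.ker = P.perp u := by
  let b := finBasis F u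
  refine ⟨LinearMap.pi fun i => P.B (b i), ?_⟩
  ext y
  simp only [LinearMap.mem_ker, funext_iff, LinearMap.pi_apply, Pi.zero_apply, mem_perp]
  refine ⟨fun h v hv => ?_, fun h i => h _ (b i).2⟩
  have h1 : ((∑ i, b.repr ⟨v, hv⟩ i • b i : u) : V) = v :=
    congrArg Subtype.val (b.sum_repr ⟨v, hv⟩)
  rw [← h1]
  simp only [Submodule.coe_sum, Submodule.coe_smul, map_sum, LinearMap.sum_apply,
    LinearMap.map_smulₛₗ, LinearMap.smul_apply, h, smul_zero, Finset.sum_const_zero]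

theorem finrank_le_inf_perp_add (x u : Submodule F V) :
    finrank F x ≤ finrank F (x ⊓ P.perp u : Submodule F V) + finrank F u := by
  obtain ⟨f, hf⟩ := P.perp_eq_ker u
  have h := finrank_le_finrank_inf_ker_add x f
  rwa [hf, finrank_fin_fun] at h

theorem finrank_le_inf_perp_span_add (x : Submodule F V) (v : V) :
    finrank F x ≤ finrank F (x ⊓ P.perp (Submodule.span F {v}) : Submodule F V) + 1 :=
  (finrank_le_inf_perp_add x _).trans
    (Nat.add_le_add_left (by simpa using finrank_span_le_card (R := F) ({v} : Set V)) _)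

/-- Let c be a complement of x ∩ y in y. A vector of x orthogonal to c is orthogonal to all of y,
hence lies in y by maximality. So x ∩ c^⊥ ⊆ x ∩ y, and dim x ≤ dim(x ∩ y) + dim c = dim y. -/
theorem finrank_le_of_maximal {x y : Submodule F V} (hx : P.Iso x)
    (hy : Maximal P.Iso y) : finrank F x ≤ finrank F y := by
  obtain ⟨c, hc1, hc2⟩ : ∃ c, (x ⊓ y) ⊔ c = y ∧ finrank F c + finrank F (x ⊓ y : Submodule F V)
      = finrank F y := by
    obtain ⟨c, hc⟩ := Submodule.exists_isCompl (x ⊓ y)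
    have h1 : (x ⊓ y) ⊔ (c ⊓ y) = y := by
      rw [← sup_inf_assoc_of_le c inf_le_right, hc.sup_eq_top, top_inf_eq]
    refine ⟨c ⊓ y, h1, ?_⟩
    have h2 := Submodule.finrank_sup_add_finrank_inf_eq (x ⊓ y) (c ⊓ y)
    have h3 : (x ⊓ y) ⊓ (c ⊓ y) = ⊥ :=
      eq_bot_iff.2 ((inf_le_inf_left _ inf_le_left).trans hc.inf_eq_bot.le)
    rw [h1, h3, finrank_bot] at h2
    omega
  have h1 := P.finrank_le_inf_perp_add x c
  have h2 : x ⊓ P.perp c ≤ x ⊓ y := by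
    refine le_inf inf_le_left fun v hv => mem_of_maximal hy (hx.1 v hv.1) ?_
    rw [← hc1, perp_sup]
    exact ⟨fun w hw => hx.2 w hw.1 v hv.1, hv.2⟩
  have h3 := Submodule.finrank_mono h2
  omega

theorem maximal_of_finrank {d : ℕ} (hd : ∀ x, Maximal P.Iso x → finrank F x = d) [Finite V]
    {y : Submodule F V} (hy : P.Iso y) (h : finrank F y = d) : Maximal P.Iso y := by
  obtain ⟨x, hyx, hx⟩ := exists_maximal_ge hy
  rwa [Submodule.eq_of_le_of_finrank_eq hyx (by rw [h, hd x hx])]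

end FiniteDimensional

end PolarSpace

/-! ### Neighbours of a maximal isotropic subspace -/

namespace PolarSpace

variable {F V : Type*} [Field F] [AddCommGroup V] [Module F V] {P : PolarSpace F V}
  {d : ℕ}

theorem iso_inf_perp_sup_span {x : Submodule F V} (hx : P.Iso x) {v : V} (hv : P.Singular v) :
    P.Iso (x ⊓ P.perp (Submodule.span F {v}) ⊔ Submodule.span F {v}) :=
  (hx.mono inf_le_left).sup_span hv fun _ hw => P.refl _ _ (mem_perp_span_singleton.1 hw.2)

section FiniteDimensional

variable [FiniteDimensional F V]

theorem finrank_inf_perp_span_of_notMem {x : Submodule F V}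
    (hx : Maximal P.Iso x) {v : V} (hv : P.Singular v) (hvx : v ∉ x) :
    finrank F (x ⊓ P.perp (Submodule.span F {v}) : Submodule F V) + 1 = finrank F x := by
  refine le_antisymm ?_ (finrank_le_inf_perp_span_add x v)
  refine Submodule.finrank_lt_finrank_of_lt (lt_of_le_of_ne inf_le_left fun h => hvx ?_)
  exact mem_of_maximal hx hv fun w hw => P.refl _ _ (mem_perp_span_singleton.1 (h.ge hw).2)

theorem finrank_inf_le_of_adj (hd : ∀ x, Maximal P.Iso x → finrank F x = d)
    {x y : Submodule F V} (hy : Maximal P.Iso y)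
    (h : finrank F (x ⊓ y : Submodule F V) + 1 = d) (u : Submodule F V) :
    finrank F (y ⊓ u : Submodule F V) ≤ finrank F (x ⊓ u : Submodule F V) + 1 := by
  have h1 := finrank_add_le_finrank_add_inf (a := y ⊓ u) (b := x ⊓ y) (c := y) inf_le_left
    inf_le_right
  have h2 : (y ⊓ u) ⊓ (x ⊓ y) ≤ x ⊓ u := fun w hw => ⟨hw.2.1, hw.1.2⟩
  have h3 := Submodule.finrank_mono h2
  rw [hd y hy] at h1
  omega

theorem finrank_inf_ker_add_one {x : Submodule F V} {v : V} (hvx : v ∈ x) {φ : V →ₗ[F] F}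
    (hφ : φ v ≠ 0) : finrank F (x ⊓ φ.ker : Submodule F V) + 1 = finrank F x := by
  refine le_antisymm (Submodule.finrank_lt_finrank_of_lt (lt_of_le_of_ne inf_le_left
    fun h => hφ (h.ge hvx).2)) ?_
  simpa using finrank_le_finrank_inf_ker_add x φ

/-- Otherwise the functional B(v, ·) is a combination of the B(b_i, ·) for a basis b of h. Then v
differs from a vector of h by a singular vector of the radical, which is zero. Isotropy of the span
of h and v is what makes that difference singular. -/
theorem exists_mem_perp_of_notMem [Finite F] {h : Submodule F V} {v : V}
    (hs : P.Iso (h ⊔ Submodule.span F {v})) (hv : v ∉ h) : ∃ w ∈ P.perp h, P.B v w ≠ 0 := by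
  by_contra! hc
  let b := finBasis F h
  have h1 : P.B v ∈ Submodule.span F (Set.range fun i => P.B (b i)) := by
    refine mem_span_of_iInf_ker_le_ker fun w hw => hc w fun z hz => ?_
    have h1 : ((∑ i, b.repr ⟨z, hz⟩ i • b i : h) : V) = z :=
      congrArg Subtype.val (b.sum_repr ⟨z, hz⟩)
    have h2 : ∀ i, P.B (b i) w = 0 := by simpa using hw
    rw [← h1]
    simp only [Submodule.coe_sum, Submodule.coe_smul, map_sum, LinearMap.sum_apply,
      LinearMap.map_smulₛₗ, LinearMap.smul_apply, h2, smul_zero, Finset.sum_const_zero]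
  obtain ⟨c, hc⟩ := (Submodule.mem_span_range_iff_exists_fun F).1 h1
  -- The first argument of the form is σ-semilinear, so the coefficients must be pulled back through
  -- σ; a field endomorphism of a finite field is surjective.
  have hσ : Function.Surjective P.σ := Finite.surjective_of_injective P.σ.injective
  choose e he using hσ
  have h2 : v - ∑ i, e (c i) • (b i : V) = 0 := by
    refine P.radical _ (hs.1 _ (sub_mem (Submodule.mem_sup_right
      (Submodule.mem_span_singleton_self v)) (Submodule.mem_sup_left
      (sum_mem fun i _ => h.smul_mem _ (b i).2)))) fun y => ?_
    simp [he, ← hc]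
  refine hv ?_
  rw [sub_eq_zero.1 h2]
  exact sum_mem fun i _ => h.smul_mem _ (b i).2

variable [Finite V]

/-- This is the projection of x towards a singular point v outside it, the source of all neighbours
constructed below. -/
theorem maximal_inf_perp_sup_span (hd : ∀ x, Maximal P.Iso x → finrank F x = d)
    {x : Submodule F V} (hx : Maximal P.Iso x) {v : V} (hv : P.Singular v) (hvx : v ∉ x) :
    Maximal P.Iso (x ⊓ P.perp (Submodule.span F {v}) ⊔ Submodule.span F {v}) := by
  refine maximal_of_finrank hd (iso_inf_perp_sup_span hx.1 hv) ?_
  rw [finrank_sup_span_singleton_of_notMem fun h : v ∈ x ⊓ _ => hvx h.1,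
    finrank_inf_perp_span_of_notMem hx hv hvx, hd x hx]

theorem inf_maximal_inf_perp_sup_span (hd : ∀ x, Maximal P.Iso x → finrank F x = d)
    {x : Submodule F V} (hx : Maximal P.Iso x) {v : V} (hv : P.Singular v) (hvx : v ∉ x) :
    finrank F (x ⊓ (x ⊓ P.perp (Submodule.span F {v}) ⊔ Submodule.span F {v}) :
      Submodule F V) + 1 = d := by
  have h1 := finrank_inf_perp_span_of_notMem hx hv hvx
  rw [hd x hx] at h1
  refine le_antisymm ?_ ?_
  · rw [← hd x hx]
    refine Submodule.finrank_lt_finrank_of_lt (lt_of_le_of_ne inf_le_left fun h => hvx ?_)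
    have h2 := Submodule.eq_of_le_of_finrank_eq (inf_eq_left.1 h)
      (by rw [hd x hx, hd _ (maximal_inf_perp_sup_span hd hx hv hvx)])
    rw [h2]
    exact Submodule.mem_sup_right (Submodule.mem_span_singleton_self v)
  · rw [← h1]
    exact Nat.add_le_add_right (Submodule.finrank_mono (le_inf inf_le_left le_sup_left)) 1

theorem exists_adj_finrank_inf_lt (hd : ∀ x, Maximal P.Iso x → finrank F x = d)
    {x u : Submodule F V} (hx : Maximal P.Iso x) (hu : P.Iso u) (hux : ¬ u ≤ x) :
    ∃ y, Maximal P.Iso y ∧ finrank F (x ⊓ y : Submodule F V) + 1 = d ∧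
      finrank F (x ⊓ u : Submodule F V) < finrank F (y ⊓ u : Submodule F V) := by
  obtain ⟨v, hvu, hvx⟩ := Set.not_subset.1 hux
  have hv := hu.1 v hvu
  refine ⟨_, maximal_inf_perp_sup_span hd hx hv hvx, inf_maximal_inf_perp_sup_span hd hx hv hvx,
    Submodule.finrank_lt_finrank_of_lt (lt_of_le_of_ne ?_ fun h => hvx ?_)⟩
  · exact fun w hw => ⟨Submodule.mem_sup_left
      ⟨hw.1, mem_perp_span_singleton.2 (hu.2 v hvu w hw.2)⟩, hw.2⟩
  · exact (h.ge ⟨Submodule.mem_sup_right (Submodule.mem_span_singleton_self v), hvu⟩).1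

/-- For v in u outside x, a neighbour y containing u meets x inside x ∩ v^⊥. Dimensions force
equality there, so y must be (x ∩ v^⊥) + ⟨v⟩. -/
theorem existsUnique_adj_ge (hd : ∀ x, Maximal P.Iso x → finrank F x = d)
    {x u : Submodule F V} (hx : Maximal P.Iso x) (hu : P.Iso u)
    (h : finrank F (x ⊓ u : Submodule F V) + 1 = finrank F u) :
    ∃! y, Maximal P.Iso y ∧ finrank F (x ⊓ y : Submodule F V) + 1 = d ∧ u ≤ y := by
  have hux : ¬ u ≤ x := fun h1 => by rw [inf_eq_right.2 h1] at h; omega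
  obtain ⟨v, hvu, hvx⟩ := Set.not_subset.1 hux
  have hv := hu.1 v hvu
  have hux' : u ≤ x ⊓ P.perp (Submodule.span F {v}) ⊔ Submodule.span F {v} := by
    have h1 : (x ⊓ u) ⊔ Submodule.span F {v} = u := by
      refine Submodule.eq_of_le_of_finrank_eq
        (sup_le inf_le_right ((Submodule.span_singleton_le_iff_mem _ _).2 hvu)) ?_
      rw [finrank_sup_span_singleton_of_notMem fun h : v ∈ x ⊓ _ => hvx h.1, h]
    rw [← h1]
    refine sup_le_sup_right (fun w hw => ⟨hw.1, mem_perp_span_singleton.2 (hu.2 v hvu w hw.2)⟩) _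
  refine ⟨_, ⟨maximal_inf_perp_sup_span hd hx hv hvx,
    inf_maximal_inf_perp_sup_span hd hx hv hvx, hux'⟩, ?_⟩
  rintro y ⟨hy1, hy2, hy3⟩
  have h1 : x ⊓ y ≤ x ⊓ P.perp (Submodule.span F {v}) :=
    fun w hw => ⟨hw.1, mem_perp_span_singleton.2 (hy1.1.2 v (hy3 hvu) w hw.2)⟩
  have h2 : x ⊓ y = x ⊓ P.perp (Submodule.span F {v}) := by
    refine Submodule.eq_of_le_of_finrank_eq h1 ?_
    have := finrank_inf_perp_span_of_notMem hx hv hvx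
    rw [hd x hx] at this
    omega
  symm
  refine Submodule.eq_of_le_of_finrank_eq (sup_le ?_ ?_) ?_
  · rw [← h2]; exact inf_le_right
  · exact (Submodule.span_singleton_le_iff_mem _ _).2 (hy3 hvu)
  · rw [hd y hy1, hd _ (maximal_inf_perp_sup_span hd hx hv hvx)]

theorem exists_adj_inf_eq [Finite F] (hd : ∀ x, Maximal P.Iso x → finrank F x = d)
    {x h : Submodule F V} (hx : Maximal P.Iso x) (hhx : h ≤ x) (hh : finrank F h + 1 = d) :
    ∃ y, Maximal P.Iso y ∧ x ⊓ y = h := by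
  obtain ⟨v, hvx, hvh⟩ := exists_mem_notMem_of_finrank_lt (F := F) (a := h) (b := x)
    (by rw [hd x hx]; omega)
  obtain ⟨w, hw, hvw⟩ := exists_mem_perp_of_notMem (P := P) (h := h) (v := v)
    (hx.1.mono (sup_le hhx ((Submodule.span_singleton_le_iff_mem _ _).2 hvx))) hvh
  -- Adding a multiple of v makes w singular. It keeps w orthogonal to h and leaves B(v, w) ≠ 0
  -- unchanged, so the new vector stays outside x.
  obtain ⟨a, ha⟩ := P.hyperbolic v w (hx.1.1 v hvx) hvw
  have h1 : w + a • v ∈ P.perp h := add_mem hw (Submodule.smul_mem _ _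
    fun z hz => hx.1.2 z (hhx hz) v hvx)
  have h2 : w + a • v ∉ x := fun h => hvw <| by
    simpa [P.self v (hx.1.1 v hvx)] using hx.1.2 v hvx _ h
  have h3 := (hx.1.mono hhx).sup_span ha h1
  have hy : Maximal P.Iso (h ⊔ Submodule.span F {w + a • v}) := maximal_of_finrank hd h3
    (by rw [finrank_sup_span_singleton_of_notMem fun h => h2 (hhx h), hh])
  refine ⟨_, hy, (Submodule.eq_of_le_of_finrank_le (le_inf hhx le_sup_left) ?_).symm⟩
  have h4 : x ⊓ (h ⊔ Submodule.span F {w + a • v}) < h ⊔ Submodule.span F {w + a • v} :=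
    lt_of_le_of_ne inf_le_right fun h5 => h2 (inf_eq_right.1 h5
      (Submodule.mem_sup_right (Submodule.mem_span_singleton_self _)))
  have h5 := Submodule.finrank_lt_finrank_of_lt h4
  rw [hd _ hy] at h5
  omega

/-- Descent on dim(x ∩ u): replace x by a y that meets it in a hyperplane missing some v ∈ x ∩ u. A
vector of y ∩ u is orthogonal to that hyperplane and to v, hence to x, and so lies in x. Thus y ∩ u
⊆ x ∩ u, and v is lost. -/
theorem exists_maximal_disjoint [Finite F] (hd : ∀ x, Maximal P.Iso x → finrank F x = d)
    {u : Submodule F V} (hu : P.Iso u) : ∃ y, Maximal P.Iso y ∧ y ⊓ u = ⊥ := by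
  have key : ∀ n, ∀ x, Maximal P.Iso x → finrank F (x ⊓ u : Submodule F V) = n →
      ∃ y, Maximal P.Iso y ∧ y ⊓ u = ⊥ := by
    intro n
    induction n using Nat.strong_induction_on with
    | _ n ih =>
      intro x hx hn
      by_cases h0 : x ⊓ u = ⊥
      · exact ⟨x, hx, h0⟩
      · obtain ⟨v, hv, hv0⟩ := (Submodule.ne_bot_iff _).1 h0
        obtain ⟨φ, hφ, -⟩ := exists_linearMap_ne_zero_of_ne_zero (F := F) hv0 hv0
        have h1 := finrank_inf_ker_add_one hv.1 hφ
        rw [hd x hx] at h1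
        obtain ⟨y, hy, hxy⟩ := exists_adj_inf_eq hd hx (inf_le_left : x ⊓ φ.ker ≤ x) h1
        refine ih _ ?_ y hy rfl
        rw [← hn]
        refine Submodule.finrank_lt_finrank_of_lt (lt_of_le_of_ne ?_ fun h => hφ ?_)
        · refine le_inf (fun z hz => ?_) inf_le_right
          refine mem_of_maximal hx (hu.1 z hz.2) ?_
          have h2 : (x ⊓ φ.ker) ⊔ Submodule.span F {v} = x := by
            refine Submodule.eq_of_le_of_finrank_eq
              (sup_le inf_le_left ((Submodule.span_singleton_le_iff_mem _ _).2 hv.1)) ?_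
            rw [finrank_sup_span_singleton_of_notMem fun h : v ∈ x ⊓ _ => hφ h.2, h1, hd x hx]
          rw [← h2, perp_sup]
          refine ⟨fun w hw => hy.1.2 w ?_ z hz.1, mem_perp_span_singleton.2 (hu.2 v hv.2 z hz.2)⟩
          rw [← hxy] at hw
          exact hw.2
        · have : v ∈ x ⊓ y := ⟨hv.1, (h.ge hv).1⟩
          rw [hxy] at this
          exact this.2
  obtain ⟨x, -, hx⟩ := exists_maximal_ge hu
  exact key _ x hx rfl

end FiniteDimensional

end PolarSpace

/-! ### The order of a polar space -/

namespace PolarSpace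

variable {F V : Type*} [Field F] [AddCommGroup V] [Module F V] {P : PolarSpace F V}

variable (P) in
/-- The number of maximal isotropic subspaces that contain `h`. -/
noncomputable def numMaximal (h : Submodule F V) : ℕ :=
  Nat.card {x : Submodule F V // Maximal P.Iso x ∧ h ≤ x}

variable [FiniteDimensional F V] {d : ℕ}

theorem exists_inf_perp_eq_span (hd : ∀ x, Maximal P.Iso x → finrank F x = d)
    {x y h : Submodule F V} (hx : Maximal P.Iso x) (hy : Maximal P.Iso y) (hxy : x ⊓ y = ⊥)
    (hhx : h ≤ x) (hh : finrank F h + 1 = d) :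
    ∃ p ≠ 0, y ⊓ P.perp h = Submodule.span F {p} := by
  have h1 := P.finrank_le_inf_perp_add y h
  rw [hd y hy] at h1
  obtain ⟨s, hsx, hsh⟩ := exists_mem_notMem_of_finrank_lt (F := F) (a := h) (b := x)
    (by rw [hd x hx]; omega)
  have h2 : h ⊔ Submodule.span F {s} = x := Submodule.eq_of_le_of_finrank_eq
    (sup_le hhx ((Submodule.span_singleton_le_iff_mem _ _).2 hsx))
    (by rw [finrank_sup_span_singleton_of_notMem hsh, hh, hd x hx])
  have h3 := P.finrank_le_inf_perp_span_add (y ⊓ P.perp h) s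
  have h4 : (y ⊓ P.perp h) ⊓ P.perp (Submodule.span F {s}) = ⊥ := by
    rw [inf_assoc, ← perp_sup, h2]
    refine eq_bot_iff.2 ?_
    rw [← hxy]
    exact le_inf (inf_perp_le_of_maximal hx hy.1) inf_le_left
  rw [h4, finrank_bot] at h3
  have h5 : finrank F (y ⊓ P.perp h : Submodule F V) = 1 := by omega
  obtain ⟨p, hp, hp0⟩ := exists_mem_notMem_of_finrank_lt (F := F) (a := ⊥)
    (b := y ⊓ P.perp h) (by rw [finrank_bot]; omega)
  rw [Submodule.mem_bot] at hp0
  exact ⟨p, hp0, (Submodule.eq_of_le_of_finrank_eq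
    ((Submodule.span_singleton_le_iff_mem _ _).2 hp) (by rw [finrank_span_singleton hp0, h5])).symm⟩

/-- Singular vectors of x^⊥ lie in x, so x^⊥ meets a complement of x in a subspace without nonzero
singular vectors. That subspace has dimension at least dim V - 2 dim x. -/
theorem finrank_lt_two_mul_finrank_add {k : ℕ}
    (hk : ∀ c : Submodule F V, k ≤ finrank F c → ∃ v ∈ c, v ≠ 0 ∧ P.Singular v)
    {x : Submodule F V} (hx : Maximal P.Iso x) :
    finrank F V < 2 * finrank F x + k := by
  obtain ⟨c, hc⟩ := Submodule.exists_isCompl x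
  have h1 := P.finrank_le_inf_perp_add ⊤ x
  have h2 := finrank_add_le_finrank_add_inf (a := c) (b := P.perp x) (c := ⊤) le_top le_top
  have h3 := Submodule.finrank_add_eq_of_isCompl hc
  rw [top_inf_eq, finrank_top] at h1
  rw [finrank_top] at h2
  by_contra! h4
  obtain ⟨v, hv, hv0, hvs⟩ := hk (c ⊓ P.perp x) (by omega)
  have h5 := mem_of_maximal hx hvs hv.2
  exact hv0 ((Submodule.mem_bot F).1 (hc.inf_eq_bot ▸ ⟨h5, hv.1⟩))

variable [Finite V]

/-- When h and h' are opposite, x ∩ h'^⊥ is a line for every maximal x ⊇ h. Joining it to h' sends x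
to a maximal subspace over h', and the same construction in the other direction recovers x. -/
theorem transport_maximal (hd : ∀ x, Maximal P.Iso x → finrank F x = d)
    {h h' x : Submodule F V} (hh : finrank F h + 1 = d) (hh' : finrank F h' + 1 = d)
    (hi' : P.Iso h') (h1 : h ⊓ P.perp h' = ⊥) (h2 : h' ⊓ P.perp h = ⊥)
    (hx : Maximal P.Iso x) (hhx : h ≤ x) :
    Maximal P.Iso (h' ⊔ x ⊓ P.perp h') ∧
      h ⊔ (h' ⊔ x ⊓ P.perp h') ⊓ P.perp h = x := by
  have hxd := hd x hx
  have h3 := P.finrank_le_inf_perp_add x h'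
  obtain ⟨v, hv, hv0⟩ := exists_mem_notMem_of_finrank_lt (F := F) (a := ⊥)
    (b := x ⊓ P.perp h') (by rw [finrank_bot]; omega)
  rw [Submodule.mem_bot] at hv0
  have hvh : v ∉ h := fun hvh => hv0 ((Submodule.mem_bot F).1 (h1 ▸ ⟨hvh, hv.2⟩))
  have hvp : v ∈ P.perp h := fun w hw => hx.1.2 w (hhx hw) v hv.1
  have hvh' : v ∉ h' := fun hvh' => hv0 ((Submodule.mem_bot F).1 (h2 ▸ ⟨hvh', hvp⟩))
  have hvx : h ⊔ Submodule.span F {v} = x := Submodule.eq_of_le_of_finrank_eq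
    (sup_le hhx ((Submodule.span_singleton_le_iff_mem _ _).2 hv.1))
    (by rw [finrank_sup_span_singleton_of_notMem hvh, hh, hxd])
  have hle : x ⊓ P.perp h' ≤ Submodule.span F {v} := by
    rintro z ⟨hz, hz'⟩
    rw [← hvx] at hz
    obtain ⟨a, ha, b, hb, rfl⟩ := Submodule.mem_sup.1 hz
    obtain ⟨c, rfl⟩ := Submodule.mem_span_singleton.1 hb
    have : a ∈ h ⊓ P.perp h' :=
      ⟨ha, by simpa using sub_mem hz' (Submodule.smul_mem _ c hv.2)⟩
    rw [h1, Submodule.mem_bot] at this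
    rw [this, zero_add]
    exact hb
  have heq : x ⊓ P.perp h' = Submodule.span F {v} :=
    le_antisymm hle ((Submodule.span_singleton_le_iff_mem _ _).2 hv)
  have hmax : Maximal P.Iso (h' ⊔ Submodule.span F {v}) :=
    maximal_of_finrank hd (hi'.sup_span (hx.1.1 v hv.1) hv.2)
      (by rw [finrank_sup_span_singleton_of_notMem hvh', hh'])
  rw [heq]
  refine ⟨hmax, ?_⟩
  have h5 : (h' ⊔ Submodule.span F {v}) ⊓ P.perp h = Submodule.span F {v} := by
    refine le_antisymm ?_ (le_inf le_sup_right ((Submodule.span_singleton_le_iff_mem _ _).2 hvp))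
    rintro z ⟨hz, hz'⟩
    obtain ⟨a, ha, b, hb, rfl⟩ := Submodule.mem_sup.1 hz
    obtain ⟨c, rfl⟩ := Submodule.mem_span_singleton.1 hb
    have : a ∈ h' ⊓ P.perp h :=
      ⟨ha, by simpa using sub_mem hz' (Submodule.smul_mem _ c hvp)⟩
    rw [h2, Submodule.mem_bot] at this
    rw [this, zero_add]
    exact hb
  rw [h5, hvx]

theorem numMaximal_le_of_opposite (hd : ∀ x, Maximal P.Iso x → finrank F x = d)
    {h h' : Submodule F V} (hh : finrank F h + 1 = d) (hh' : finrank F h' + 1 = d)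
    (hi' : P.Iso h') (h1 : h ⊓ P.perp h' = ⊥) (h2 : h' ⊓ P.perp h = ⊥) :
    P.numMaximal h ≤ P.numMaximal h' := by
  refine Nat.card_le_card_of_injective
    (fun x => ⟨h' ⊔ x.1 ⊓ P.perp h',
      (transport_maximal hd hh hh' hi' h1 h2 x.2.1 x.2.2).1, le_sup_left⟩) ?_
  intro x y hxy
  have h3 : h' ⊔ x.1 ⊓ P.perp h' = h' ⊔ y.1 ⊓ P.perp h' := congrArg Subtype.val hxy
  refine Subtype.ext ?_
  rw [← (transport_maximal hd hh hh' hi' h1 h2 x.2.1 x.2.2).2, h3,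
    (transport_maximal hd hh hh' hi' h1 h2 y.2.1 y.2.2).2]

theorem numMaximal_eq_of_opposite (hd : ∀ x, Maximal P.Iso x → finrank F x = d)
    {h h' : Submodule F V} (hh : finrank F h + 1 = d) (hh' : finrank F h' + 1 = d)
    (hi : P.Iso h) (hi' : P.Iso h') (h1 : h ⊓ P.perp h' = ⊥) (h2 : h' ⊓ P.perp h = ⊥) :
    P.numMaximal h = P.numMaximal h' :=
  le_antisymm (numMaximal_le_of_opposite hd hh hh' hi' h1 h2)
    (numMaximal_le_of_opposite hd hh' hh hi h2 h1)

/-- A hyperplane of y that misses the point p = y ∩ h^⊥ is opposite to h. -/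
theorem numMaximal_eq_of_inf_ker (hd : ∀ x, Maximal P.Iso x → finrank F x = d)
    {x y h : Submodule F V} (hx : Maximal P.Iso x) (hy : Maximal P.Iso y) (hxy : x ⊓ y = ⊥)
    (hhx : h ≤ x) (hh : finrank F h + 1 = d) {p : V} (hp : y ⊓ P.perp h = Submodule.span F {p})
    {φ : V →ₗ[F] F} (hφ : φ p ≠ 0) : P.numMaximal h = P.numMaximal (y ⊓ φ.ker) := by
  have hpy : p ∈ y ⊓ P.perp h := hp.ge (Submodule.mem_span_singleton_self p)
  have h1 := finrank_inf_ker_add_one hpy.1 hφ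
  have h2 : (y ⊓ φ.ker) ⊔ Submodule.span F {p} = y := Submodule.eq_of_le_of_finrank_eq
    (sup_le inf_le_left ((Submodule.span_singleton_le_iff_mem _ _).2 hpy.1))
    (by rw [finrank_sup_span_singleton_of_notMem fun h : p ∈ y ⊓ _ => hφ h.2, h1])
  refine numMaximal_eq_of_opposite hd hh (h1.trans (hd y hy)) (hx.1.mono hhx)
    (hy.1.mono inf_le_left) ?_ ?_
  · refine eq_bot_iff.2 ?_
    rw [← hxy]
    refine le_inf (inf_le_left.trans hhx) fun s hs => mem_of_maximal hy (hx.1.1 s (hhx hs.1)) ?_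
    rw [← h2, perp_sup]
    exact ⟨hs.2, mem_perp_span_singleton.2 (P.refl _ _ (hpy.2 s hs.1))⟩
  · refine eq_bot_iff.2 fun s hs => ?_
    have h3 : s ∈ Submodule.span F {p} := by
      rw [← hp]
      exact ⟨hs.1.1, hs.2⟩
    obtain ⟨c, rfl⟩ := Submodule.mem_span_singleton.1 h3
    have h4 : c * φ p = 0 := by simpa using (hs.1.2 : φ (c • p) = 0)
    rw [(mul_eq_zero.1 h4).resolve_right hφ, zero_smul]
    exact zero_mem _

variable [Finite F]

/-- Inside a maximal y disjoint from x there is a hyperplane missing both points y ∩ h^⊥ and y ∩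
h'^⊥. It is opposite to h and h' at once. -/
theorem numMaximal_eq_of_le (hd : ∀ x, Maximal P.Iso x → finrank F x = d)
    {x h h' : Submodule F V} (hx : Maximal P.Iso x) (hhx : h ≤ x) (hhx' : h' ≤ x)
    (hh : finrank F h + 1 = d) (hh' : finrank F h' + 1 = d) :
    P.numMaximal h = P.numMaximal h' := by
  obtain ⟨y, hy, hyx⟩ := exists_maximal_disjoint hd hx.1
  rw [inf_comm] at hyx
  obtain ⟨p, hp0, hp⟩ := exists_inf_perp_eq_span hd hx hy hyx hhx hh
  obtain ⟨p', hp0', hp'⟩ := exists_inf_perp_eq_span hd hx hy hyx hhx' hh'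
  obtain ⟨φ, hφ, hφ'⟩ := exists_linearMap_ne_zero_of_ne_zero (F := F) hp0 hp0'
  rw [numMaximal_eq_of_inf_ker hd hx hy hyx hhx hh hp hφ,
    numMaximal_eq_of_inf_ker hd hx hy hyx hhx' hh' hp' hφ']

/-- Walk from x ⊇ h to y ⊇ h' through neighbours. Consecutive vertices x, z share the hyperplane x ∩
z, and the count is constant on the hyperplanes of a single vertex. -/
theorem numMaximal_eq (hd : ∀ x, Maximal P.Iso x → finrank F x = d)
    {h h' : Submodule F V} (hi : P.Iso h) (hi' : P.Iso h')
    (hh : finrank F h + 1 = d) (hh' : finrank F h' + 1 = d) :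
    P.numMaximal h = P.numMaximal h' := by
  obtain ⟨y, hhy, hy⟩ := exists_maximal_ge hi'
  have key : ∀ n, ∀ x h, Maximal P.Iso x → h ≤ x → finrank F h + 1 = d →
      d - finrank F (x ⊓ y : Submodule F V) = n → P.numMaximal h = P.numMaximal h' := by
    intro n
    induction n using Nat.strong_induction_on with
    | _ n ih =>
      intro x h hx hhx hh hn
      by_cases hyx : y ≤ x
      · exact numMaximal_eq_of_le hd hx hhx (hhy.trans hyx) hh hh'
      · obtain ⟨z, hz, hz1, hz2⟩ := exists_adj_finrank_inf_lt hd hx hy.1 hyx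
        rw [numMaximal_eq_of_le hd hx hhx (inf_le_left : x ⊓ z ≤ x) hh hz1]
        refine ih _ ?_ z (x ⊓ z) hz inf_le_right hz1 rfl
        have h1 := Submodule.finrank_mono (inf_le_left : z ⊓ y ≤ z)
        rw [hd z hz] at h1
        omega
  obtain ⟨x, hhx, hx⟩ := exists_maximal_ge hi
  exact key _ x h hx hhx hh rfl

theorem one_lt_numMaximal (hd : ∀ x, Maximal P.Iso x → finrank F x = d)
    {h : Submodule F V} (hi : P.Iso h) (hh : finrank F h + 1 = d) : 1 < P.numMaximal h := by
  obtain ⟨x, hhx, hx⟩ := exists_maximal_ge hi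
  obtain ⟨y, hy, hxy⟩ := exists_adj_inf_eq hd hx hhx hh
  have : Nontrivial {x : Submodule F V // Maximal P.Iso x ∧ h ≤ x} := by
    refine ⟨⟨x, hx, hhx⟩, ⟨y, hy, hxy.ge.trans inf_le_right⟩, fun h1 => ?_⟩
    have h2 : x = y := congrArg Subtype.val h1
    rw [← h2, inf_idem] at hxy
    rw [← hxy, hd x hx] at hh
    omega
  exact Finite.one_lt_card

/-- The order `t` of a polar space: every isotropic subspace of codimension one in a maximal one
lies in exactly `t + 1` maximal isotropic subspaces. -/
theorem exists_order (hd : ∀ x, Maximal P.Iso x → finrank F x = d) :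
    ∃ t, 0 < t ∧ ∀ h, P.Iso h → finrank F h + 1 = d → P.numMaximal h = t + 1 := by
  by_cases hex : ∃ h, P.Iso h ∧ finrank F h + 1 = d
  · obtain ⟨h, hi, hh⟩ := hex
    have h1 := one_lt_numMaximal hd hi hh
    refine ⟨P.numMaximal h - 1, by omega, fun h' hi' hh' => ?_⟩
    rw [numMaximal_eq hd hi' hi hh' hh]
    omega
  -- There is no such h, so any positive value serves.
  · exact ⟨1, one_pos, fun h hi hh => (hex ⟨h, hi, hh⟩).elim⟩

theorem two_mul_finrank_le {x : Submodule F V} (hx : Maximal P.Iso x) :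
    2 * finrank F x ≤ finrank F V := by
  have hd : ∀ y, Maximal P.Iso y → finrank F y = finrank F x := fun y hy =>
    le_antisymm (finrank_le_of_maximal hy.1 hx) (finrank_le_of_maximal hx.1 hy)
  obtain ⟨y, hy, hyx⟩ := exists_maximal_disjoint hd hx.1
  have h1 := Submodule.finrank_sup_add_finrank_inf_eq y x
  have h2 := Submodule.finrank_le (y ⊔ x)
  rw [hyx, finrank_bot, hd y hy] at h1
  omega

end PolarSpace

/-! ### Gaussian binomials and counting subspaces -/

section Counting

theorem gaussBinom_eq_prod {q : ℕ} (hq : 1 < q) (n k : ℕ) :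
    gaussBinom q n k =
      ∏ t ∈ Finset.range k, ((q : ℝ) ^ (n - t) - 1) / ((q : ℝ) ^ (t + 1) - 1) := by
  have h1 : (q : ℝ) - 1 ≠ 0 := sub_ne_zero.2 (by exact_mod_cast hq.ne')
  exact Finset.prod_congr rfl fun t _ => div_div_div_cancel_right₀ h1 _ _

theorem pow_sub_one_pos {q : ℕ} (hq : 1 < q) {m : ℕ} (hm : m ≠ 0) : 0 < (q : ℝ) ^ m - 1 :=
  sub_pos.2 (one_lt_pow₀ (by exact_mod_cast hq) hm)

theorem gaussBinom_eq_zero_of_lt {q n k : ℕ} (h : n < k) : gaussBinom q n k = 0 :=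
  Finset.prod_eq_zero (Finset.mem_range.2 h) (by simp)

theorem gaussBinom_one_right {q : ℕ} (hq : 1 < q) (n : ℕ) :
    gaussBinom q n 1 = ((q : ℝ) ^ n - 1) / ((q : ℝ) - 1) := by
  simp [gaussBinom_eq_prod hq]

theorem gaussBinom_self {q : ℕ} (hq : 1 < q) (n : ℕ) : gaussBinom q n n = 1 := by
  rw [gaussBinom_eq_prod hq, Finset.prod_div_distrib,
    ← Finset.prod_range_reflect (fun t => (q : ℝ) ^ (t + 1) - 1)]
  have h1 : ∏ t ∈ Finset.range n, ((q : ℝ) ^ (n - t) - 1) =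
      ∏ j ∈ Finset.range n, ((q : ℝ) ^ (n - 1 - j + 1) - 1) :=
    Finset.prod_congr rfl fun t ht => by
      rw [show n - t = n - 1 - t + 1 by have := Finset.mem_range.1 ht; omega]
  rw [h1, div_self]
  exact Finset.prod_ne_zero_iff.2 fun t _ => (pow_sub_one_pos hq (Nat.succ_ne_zero _)).ne'

theorem gaussBinom_succ_self {q : ℕ} (hq : 1 < q) (n : ℕ) :
    gaussBinom q (n + 1) n = ((q : ℝ) ^ (n + 1) - 1) / ((q : ℝ) - 1) := by
  rw [gaussBinom_eq_prod hq, Finset.prod_div_distrib,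
    ← Finset.prod_range_reflect (fun t => (q : ℝ) ^ (n + 1 - t) - 1)]
  have h1 : ∏ t ∈ Finset.range n, ((q : ℝ) ^ (n + 1 - (n - 1 - t)) - 1) =
      ∏ t ∈ Finset.range n, ((q : ℝ) ^ (t + 1 + 1) - 1) :=
    Finset.prod_congr rfl fun t ht => by
      rw [show n + 1 - (n - 1 - t) = t + 1 + 1 by have := Finset.mem_range.1 ht; omega]
  rw [h1, ← Finset.prod_div_distrib]
  have h2 : ∀ m : ℕ, ∏ t ∈ Finset.range m, ((q : ℝ) ^ (t + 1 + 1) - 1) / ((q : ℝ) ^ (t + 1) - 1) =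
      ((q : ℝ) ^ (m + 1) - 1) / ((q : ℝ) - 1) := by
    intro m
    induction m with
    | zero => simp [div_self (sub_ne_zero.2 (by exact_mod_cast hq.ne' : (q : ℝ) ≠ 1))]
    | succ m ih =>
      rw [Finset.prod_range_succ, ih]
      have := (pow_sub_one_pos hq (Nat.succ_ne_zero m)).ne'
      field_simp
  exact h2 n

theorem gaussBinom_mul_prod {q : ℕ} (hq : 1 < q) {n k : ℕ} (h : k ≤ n) :
    gaussBinom q n k * ∏ i ∈ Finset.range k, ((q : ℝ) ^ k - (q : ℝ) ^ i) =
      ∏ i ∈ Finset.range k, ((q : ℝ) ^ n - (q : ℝ) ^ i) := by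
  have key : ∀ m, k ≤ m → ∏ i ∈ Finset.range k, ((q : ℝ) ^ m - (q : ℝ) ^ i) =
      (∏ i ∈ Finset.range k, (q : ℝ) ^ i) * (gaussBinom q m k *
        ∏ i ∈ Finset.range k, ((q : ℝ) ^ (i + 1) - 1)) := by
    intro m hm
    rw [gaussBinom_eq_prod hq, ← Finset.prod_mul_distrib, ← Finset.prod_mul_distrib]
    refine Finset.prod_congr rfl fun i hi => ?_
    have h1 : m = i + (m - i) := by have := Finset.mem_range.1 hi; omega
    rw [div_mul_cancel₀ _ (pow_sub_one_pos hq (Nat.succ_ne_zero i)).ne', mul_sub, mul_one,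
      ← pow_add, ← h1]
  rw [key n h, key k le_rfl, gaussBinom_self hq]
  ring

variable {F V : Type*} [Field F] [Finite F] [AddCommGroup V] [Module F V] [FiniteDimensional F V]

theorem card_submodule_mul_card_linearIndependent (k : ℕ) :
    Nat.card {s : Fin k → V // LinearIndependent F s} =
      Nat.card {u : Submodule F V // finrank F u = k} *
        ∏ i : Fin k, (Nat.card F ^ k - Nat.card F ^ (i : ℕ)) := by
  have : Finite V := Module.finite_of_finite F
  have := Fintype.ofFinite F
  have := Fintype.ofFinite {u : Submodule F V // finrank F u = k}
  let f : (Σ u : {u : Submodule F V // finrank F u = k},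
      {s : Fin k → u.1 // LinearIndependent F s}) → {s : Fin k → V // LinearIndependent F s} :=
    fun a => ⟨fun i => (a.2.1 i : V), a.2.2.map' a.1.1.subtype (Submodule.ker_subtype _)⟩
  have hspan : ∀ a, Submodule.span F (Set.range (f a).1) = a.1.1 := by
    intro a
    -- The first component of a pair is recovered as the span of its tuple; this makes the map
    -- injective across different subspaces.
    refine Submodule.eq_of_le_of_finrank_eq (Submodule.span_le.2 ?_) ?_
    · rintro _ ⟨i, rfl⟩
      exact (a.2.1 i).2
    · rw [finrank_span_eq_card (f a).2, Fintype.card_fin, a.1.2]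
  have hf : Function.Bijective f := by
    constructor
    · intro a b hab
      have h1 : a.1 = b.1 := Subtype.ext (by rw [← hspan a, hab, hspan b])
      obtain ⟨u, s⟩ := a
      obtain ⟨w, s'⟩ := b
      obtain rfl : u = w := h1
      have h2 : s = s' := Subtype.ext (funext fun i => Subtype.ext
        (congrFun (congrArg Subtype.val hab) i))
      rw [h2]
    · intro s
      refine ⟨⟨⟨Submodule.span F (Set.range s.1), by
        rw [finrank_span_eq_card s.2, Fintype.card_fin]⟩,
        ⟨fun i => ⟨s.1 i, Submodule.subset_span ⟨i, rfl⟩⟩, ?_⟩⟩, rfl⟩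
      exact linearIndependent_span s.2
  rw [← Nat.card_congr (Equiv.ofBijective f hf), Nat.card_sigma]
  have h1 : ∀ u : {u : Submodule F V // finrank F u = k},
      Nat.card {s : Fin k → u.1 // LinearIndependent F s} =
        ∏ i : Fin k, (Nat.card F ^ k - Nat.card F ^ (i : ℕ)) := by
    intro u
    rw [card_linearIndependent u.2.ge, u.2, Nat.card_eq_fintype_card]
  rw [Finset.sum_congr rfl fun u _ => h1 u, Finset.sum_const, Finset.card_univ, smul_eq_mul,
    ← Nat.card_eq_fintype_card]

theorem card_submodule_finrank_eq (k : ℕ) :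
    (Nat.card {u : Submodule F V // finrank F u = k} : ℝ) =
      gaussBinom (Nat.card F) (finrank F V) k := by
  have : Finite V := Module.finite_of_finite F
  have := Fintype.ofFinite F
  have hq : 1 < Nat.card F := Finite.one_lt_card
  rcases lt_or_ge (finrank F V) k with hk | hk
  · have : IsEmpty {u : Submodule F V // finrank F u = k} :=
      ⟨fun u => absurd u.1.finrank_le (by rw [u.2]; omega)⟩
    rw [gaussBinom_eq_zero_of_lt hk, Nat.card_of_isEmpty, Nat.cast_zero]
  · have cast_prod : ∀ n, k ≤ n → ((∏ i : Fin k, (Nat.card F ^ n - Nat.card F ^ (i : ℕ)) : ℕ) : ℝ) =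
        ∏ i ∈ Finset.range k, ((Nat.card F : ℝ) ^ n - (Nat.card F : ℝ) ^ i) := by
      intro n hn
      rw [Finset.prod_range, Nat.cast_prod]
      refine Finset.prod_congr rfl fun i _ => ?_
      rw [Nat.cast_sub (Nat.pow_le_pow_right (by omega) (by omega))]
      push_cast
      rfl
    have h1 := card_submodule_mul_card_linearIndependent (F := F) (V := V) k
    rw [card_linearIndependent hk, ← Nat.card_eq_fintype_card] at h1
    have h2 := congrArg (Nat.cast : ℕ → ℝ) h1
    rw [Nat.cast_mul, cast_prod _ hk, cast_prod _ le_rfl, ← gaussBinom_mul_prod hq hk] at h2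
    refine (mul_right_cancel₀ (Finset.prod_ne_zero_iff.2 fun i hi => ?_) h2).symm
    exact (sub_pos.2 (pow_lt_pow_right₀ (by exact_mod_cast hq) (Finset.mem_range.1 hi))).ne'

theorem card_submodule_ge_finrank_eq (w : Submodule F V) {k : ℕ} (hk : finrank F w ≤ k) :
    (Nat.card {u : Submodule F V // w ≤ u ∧ finrank F u = k} : ℝ) =
      gaussBinom (Nat.card F) (finrank F V - finrank F w) (k - finrank F w) := by
  have h1 := Submodule.finrank_quotient_add_finrank w
  rw [show finrank F V - finrank F w = finrank F (V ⧸ w) by omega, ← card_submodule_finrank_eq]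
  have hfin : ∀ p : Submodule F (V ⧸ w),
      finrank F (p.comap w.mkQ) = finrank F p + finrank F w := by
    intro p
    have h2 := LinearMap.finrank_range_add_finrank_ker (w.mkQ.domRestrict (p.comap w.mkQ))
    have h3 : (w.mkQ.domRestrict (p.comap w.mkQ)).range = p := by
      rw [LinearMap.range_domRestrict, Submodule.map_comap_eq_of_surjective w.mkQ_surjective]
    have h4 : finrank F (w.mkQ.domRestrict (p.comap w.mkQ)).ker = finrank F w := by
      rw [LinearMap.ker_domRestrict, Submodule.ker_mkQ,
        ← Submodule.finrank_map_subtype_eq, Submodule.map_comap_subtype,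
        inf_eq_right.2 (Submodule.le_comap_mkQ w p)]
    rw [h3, h4] at h2
    exact h2.symm
  congr 1
  symm
  refine Nat.card_congr (Equiv.ofBijective (fun p => ⟨p.1.comap w.mkQ,
    Submodule.le_comap_mkQ w p.1, by rw [hfin, p.2]; omega⟩) ⟨fun p p' h => ?_, fun u => ?_⟩)
  · exact Subtype.ext (Submodule.comap_injective_of_surjective w.mkQ_surjective
      (congrArg Subtype.val h))
  · have h5 : (u.1.map w.mkQ).comap w.mkQ = u.1 := by
      rw [Submodule.comap_map_mkQ, sup_eq_right.2 u.2.1]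
    refine ⟨⟨u.1.map w.mkQ, ?_⟩, Subtype.ext h5⟩
    have h6 := hfin (u.1.map w.mkQ)
    rw [h5, u.2.2] at h6
    omega

theorem card_submodule_between {w x : Submodule F V} (hwx : w ≤ x) {k : ℕ}
    (hk : finrank F w ≤ k) :
    (Nat.card {u : Submodule F V // w ≤ u ∧ u ≤ x ∧ finrank F u = k} : ℝ) =
      gaussBinom (Nat.card F) (finrank F x - finrank F w) (k - finrank F w) := by
  have h1 : finrank F (w.comap x.subtype) = finrank F w := by
    rw [← Submodule.finrank_map_subtype_eq, Submodule.map_comap_subtype, inf_eq_right.2 hwx]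
  have h2 := card_submodule_ge_finrank_eq (w.comap x.subtype) (hk := h1.trans_le hk)
  rw [h1] at h2
  rw [← h2]
  congr 1
  symm
  refine Nat.card_congr (Equiv.ofBijective (fun u => ⟨u.1.map x.subtype, ?_,
    Submodule.map_subtype_le x u.1, by rw [Submodule.finrank_map_subtype_eq, u.2.2]⟩)
    ⟨fun p p' h => ?_, fun u => ?_⟩)
  · have h3 := Submodule.map_mono (f := x.subtype) u.2.1
    rwa [Submodule.map_comap_subtype, inf_eq_right.2 hwx] at h3
  · exact Subtype.ext (Submodule.map_injective_of_injective x.injective_subtype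
      (congrArg Subtype.val h))
  · have h4 : (u.1.comap x.subtype).map x.subtype = u.1 := by
      rw [Submodule.map_comap_subtype, inf_eq_right.2 u.2.2.1]
    refine ⟨⟨u.1.comap x.subtype, Submodule.comap_mono u.2.1, ?_⟩, Subtype.ext h4⟩
    rw [← Submodule.finrank_map_subtype_eq, h4, u.2.2.2]

end Counting

/-! ### Zeros of quadratic forms over finite fields -/

section Forms

variable {F V : Type*} [Field F] [Finite F] [AddCommGroup V] [Module F V] [FiniteDimensional F V]

/-- Chevalley–Warning: in coordinates Q has degree at most 2, below the number of variables. The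
characteristic divides the number of zeros, so the origin is not the only one. -/
theorem QuadraticForm.exists_ne_zero_eq_zero (Q : QuadraticForm F V) (h : 3 ≤ finrank F V) :
    ∃ v, v ≠ 0 ∧ Q v = 0 := by
  classical
  have := Fintype.ofFinite F
  -- The bilinear form A with A(v, v) = Q(v) need not be symmetric, so characteristic 2 is covered.
  obtain ⟨A, hA⟩ := LinearMap.BilinMap.toQuadraticMap_surjective Q
  let b := finBasis F V
  let f : MvPolynomial (Fin (finrank F V)) F := ∑ i, ∑ j,
    MvPolynomial.C (A (b i) (b j)) * (MvPolynomial.X i * MvPolynomial.X j)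
  have hf : ∀ c, MvPolynomial.eval c f = Q (∑ i, c i • b i) := by
    intro c
    simp only [f, map_sum, map_mul, MvPolynomial.eval_C, MvPolynomial.eval_X, ← hA,
      LinearMap.BilinMap.toQuadraticMap_apply, LinearMap.sum_apply, map_smul,
      LinearMap.smul_apply, smul_eq_mul, Finset.mul_sum]
    rw [Finset.sum_comm]
    exact Finset.sum_congr rfl fun i _ => Finset.sum_congr rfl fun j _ => by ring
  have hdeg : f.totalDegree < Fintype.card (Fin (finrank F V)) := by
    rw [Fintype.card_fin]
    refine lt_of_le_of_lt ?_ h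
    refine MvPolynomial.totalDegree_finsetSum_le fun i _ =>
      MvPolynomial.totalDegree_finsetSum_le fun j _ => ?_
    refine (MvPolynomial.totalDegree_mul _ _).trans ?_
    rw [MvPolynomial.totalDegree_C, zero_add]
    refine (MvPolynomial.totalDegree_mul _ _).trans ?_
    rw [MvPolynomial.totalDegree_X, MvPolynomial.totalDegree_X]
  obtain ⟨p, hp⟩ := CharP.exists F
  have hdvd := char_dvd_card_solutions p hdeg
  have hp1 : p ≠ 1 := CharP.char_ne_one F p
  have hcard : 1 < Fintype.card {c // MvPolynomial.eval c f = 0} := by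
    have h0 : MvPolynomial.eval 0 f = 0 := by rw [hf]; simp
    have hpos : 0 < Fintype.card {c // MvPolynomial.eval c f = 0} :=
      Fintype.card_pos_iff.2 ⟨⟨0, h0⟩⟩
    refine lt_of_le_of_ne hpos fun h1 => hp1 ?_
    rw [← h1] at hdvd
    exact Nat.dvd_one.1 hdvd
  obtain ⟨c, hc⟩ := Fintype.exists_ne_of_one_lt_card hcard ⟨0, by rw [hf]; simp⟩
  refine ⟨∑ i, c.1 i • b i, fun h0 => hc (Subtype.ext (funext fun i => ?_)), by rw [← hf, c.2]⟩
  exact Fintype.linearIndependent_iff.1 b.linearIndependent c.1 h0 i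

end Forms

/-! ### Trace, norm and isotropic vectors of Hermitian forms -/

section Hermitian

variable {F V : Type*} [Field F] [Finite F] [AddCommGroup V] [Module F V]

theorem exists_generator_units_of_card_sq {r : ℕ} (hr : Nat.card F = r ^ 2) :
    ∃ g : Fˣ, (∀ b : Fˣ, ∃ k : ℕ, b = g ^ k) ∧ orderOf g = (r + 1) * (r - 1) ∧ 1 < r := by
  obtain ⟨g, hg⟩ := IsCyclic.exists_zpow_surjective (G := Fˣ)
  have hr1 : 1 < r := by
    have h1 : 1 < Nat.card F := Finite.one_lt_card
    rw [hr] at h1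
    exact lt_of_not_ge fun h => by interval_cases r <;> simp at h1
  refine ⟨g, fun b => ?_, ?_, hr1⟩
  · obtain ⟨k, hk⟩ := (mem_powers_iff_mem_zpowers (x := g)).2 (Subgroup.mem_zpowers_iff.2 (hg b))
    exact ⟨k, hk.symm⟩
  · rw [orderOf_eq_card_of_forall_mem_zpowers fun b => Subgroup.mem_zpowers_iff.2 (hg b),
      Nat.card_units, hr]
    exact Nat.sq_sub_sq r 1

/-- Surjectivity of the trace onto the fixed field. One c of nonzero trace suffices, since scaling
by fixed elements then reaches every b. If the trace vanished, then 2 = 0 and g^r = g for a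
generator g, against its order r² - 1. -/
theorem exists_add_apply_eq {r : ℕ} (hr : Nat.card F = r ^ 2) {σ : F →+* F}
    (hσ : ∀ a, σ a = a ^ r) {b : F} (hb : σ b = b) : ∃ a, a + σ a = b := by
  have := Fintype.ofFinite F
  have hσσ : ∀ a, σ (σ a) = a := fun a => by
    rw [hσ, hσ, ← pow_mul, ← sq, ← hr, Nat.card_eq_fintype_card, FiniteField.pow_card]
  obtain ⟨c, hc⟩ : ∃ c, c + σ c ≠ 0 := by
    by_contra! h
    obtain ⟨g, -, hg, hr1⟩ := exists_generator_units_of_card_sq hr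
    have h1 : (1 : F) + 1 = 0 := by simpa using h 1
    have h2 : (g : F) ^ r = g := by
      rw [← hσ, eq_neg_of_add_eq_zero_right (h g), neg_eq_iff_add_eq_zero, ← two_mul,
        ← one_add_one_eq_two, h1, zero_mul]
    have h3 : g ^ (r - 1) = 1 := by
      have h4 : g ^ (r - 1) * g = 1 * g := by
        rw [← pow_succ, Nat.sub_add_cancel hr1.le, one_mul]
        exact Units.ext (by simpa using h2)
      exact mul_right_cancel h4
    have h5 := Nat.le_of_dvd (by omega) (orderOf_dvd_of_pow_eq_one h3)
    rw [hg] at h5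
    nlinarith [Nat.sub_pos_of_lt hr1]
  refine ⟨c * (b / (c + σ c)), ?_⟩
  rw [map_mul, map_div₀, map_add, hb, hσσ, add_comm (σ c) c, ← add_mul, mul_div_cancel₀ _ hc]

/-- Surjectivity of the norm a ↦ a^{r+1}. If g^k is fixed by σ, then r² - 1 divides k(r - 1), so r +
1 divides k. -/
theorem exists_mul_apply_eq {r : ℕ} (hr : Nat.card F = r ^ 2) {σ : F →+* F}
    (hσ : ∀ a, σ a = a ^ r) {b : F} (hb : σ b = b) : ∃ a, a * σ a = b := by
  rcases eq_or_ne b 0 with rfl | hb0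
  · exact ⟨0, by simp⟩
  obtain ⟨g, hg, ho, hr1⟩ := exists_generator_units_of_card_sq hr
  obtain ⟨k, hk⟩ := hg (Units.mk0 b hb0)
  have h1 : g ^ (k * (r - 1)) = 1 := by
    rw [pow_mul, ← hk]
    have h2 : Units.mk0 b hb0 ^ (r - 1) * Units.mk0 b hb0 = 1 * Units.mk0 b hb0 := by
      rw [← pow_succ, Nat.sub_add_cancel hr1.le, one_mul]
      exact Units.ext (by simpa [hσ] using hb)
    exact mul_right_cancel h2
  have h2 := orderOf_dvd_of_pow_eq_one h1
  rw [ho] at h2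
  obtain ⟨m, rfl⟩ := Nat.dvd_of_mul_dvd_mul_right (Nat.sub_pos_of_lt hr1) h2
  refine ⟨(g ^ m : Fˣ), ?_⟩
  have h3 : b = ((g ^ ((r + 1) * m) : Fˣ) : F) := by rw [← hk]; rfl
  rw [hσ, h3, ← Units.val_pow_eq_pow_val, ← Units.val_mul, ← pow_mul, ← pow_add]
  congr 2
  ring

theorem LinearMap.IsSymm.exists_ne_zero_eq_zero [FiniteDimensional F V] {r : ℕ}
    (hr : Nat.card F = r ^ 2) {σ : F →+* F} (hσ : ∀ a, σ a = a ^ r) {B : V →ₛₗ[σ] V →ₗ[F] F}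
    (hB : B.IsSymm) (c : Submodule F V) (hc : 2 ≤ finrank F c) : ∃ v ∈ c, v ≠ 0 ∧ B v v = 0 := by
  obtain ⟨v, hv, hv0⟩ := exists_mem_notMem_of_finrank_lt (F := F) (a := ⊥) (b := c)
    (by rw [finrank_bot]; omega)
  rw [Submodule.mem_bot] at hv0
  have h1 := finrank_le_finrank_inf_ker_add c (B v)
  rw [finrank_self] at h1
  obtain ⟨w, hw, hw0⟩ := exists_mem_notMem_of_finrank_lt (F := F) (a := ⊥) (b := c ⊓ (B v).ker)
    (by rw [finrank_bot]; omega)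
  rw [Submodule.mem_bot] at hw0
  have hvw : B v w = 0 := hw.2
  have hwv : B w v = 0 := hB.isRefl _ _ hvw
  by_cases hvv : B v v = 0
  · exact ⟨v, hv, hv0, hvv⟩
  -- For orthogonal v, w the value of the form at w + a v is B(w, w) + aσ(a)B(v, v), so a must have
  -- the norm that cancels it.
  obtain ⟨a, ha⟩ := exists_mul_apply_eq hr hσ (b := -(B w w / B v v))
    (by rw [map_neg, map_div₀, hB.eq, hB.eq])
  refine ⟨w + a • v, c.add_mem hw.1 (c.smul_mem a hv), fun h => ?_, ?_⟩
  · have h2 : B v (w + a • v) = 0 := by rw [h, map_zero]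
    rw [map_add, hvw, zero_add, map_smul, smul_eq_mul] at h2
    rw [(mul_eq_zero.1 h2).resolve_right hvv, zero_smul, add_zero] at h
    exact hw0 h
  · have h3 : B (w + a • v) (w + a • v) = B w w + a * σ a * B v v := by
      simp only [map_add, LinearMap.map_smulₛₗ, LinearMap.add_apply, LinearMap.smul_apply,
        smul_eq_mul, hvw, hwv, RingHom.id_apply]
      ring
    rw [h3, ha, neg_mul, div_mul_cancel₀ _ hvv, add_neg_cancel]

end Hermitian

/-! ### The classical forms as polar spaces -/

namespace PolarSpace

variable {F V : Type*} [Field F] [AddCommGroup V] [Module F V]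

/-- The polar space of a nondegenerate symplectic form. -/
def ofSymplectic (B : V →ₗ[F] V →ₗ[F] F) (hB : B.IsAlt) (hn : B.Nondegenerate) :
    PolarSpace F V where
  σ := RingHom.id F
  B := B
  Singular _ := True
  zero := trivial
  refl := hB.isRefl
  self x _ := hB x
  comb _ _ _ _ _ _ _ := trivial
  hyperbolic _ _ _ _ := ⟨0, trivial⟩
  radical v _ h := hn.1 v h

/-- The polar space of a nondegenerate quadratic form. -/
def ofQuadratic (Q : QuadraticForm F V) (hQ : Q.Nondegenerate) : PolarSpace F V where
  σ := RingHom.id F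
  B := Q.polarBilin
  Singular v := Q v = 0
  zero := map_zero Q
  refl x y h := (QuadraticMap.polar_comm Q y x).trans h
  self x h := by simp [h]
  comb a b x y hx hy h := by
    have h1 : QuadraticMap.polar Q x y = 0 := h
    rw [QuadraticMap.map_add Q, QuadraticMap.polar_smul_left, QuadraticMap.polar_smul_right]
    simp [QuadraticMap.map_smul, hx, hy, h1]
  hyperbolic v w hv h := by
    have h1 : QuadraticMap.polar Q v w ≠ 0 := h
    refine ⟨-(Q w / QuadraticMap.polar Q v w), ?_⟩
    rw [QuadraticMap.map_add Q, QuadraticMap.polar_smul_right, QuadraticMap.polar_comm Q w v,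
      QuadraticMap.map_smul, hv, smul_zero, add_zero, smul_eq_mul, neg_mul, div_mul_cancel₀ _ h1,
      add_neg_cancel]
  radical v hv h := by
    have h1 : v ∈ Q.radical := ⟨hv, LinearMap.ext h⟩
    rwa [hQ.radical_eq_bot, Submodule.mem_bot] at h1

/-- The polar space of a nondegenerate Hermitian form over a finite field. -/
def ofHermitian [Finite F] {r : ℕ} (hr : Nat.card F = r ^ 2) {σ : F →+* F}
    (hσ : ∀ a, σ a = a ^ r) (B : V →ₛₗ[σ] V →ₗ[F] F) (hB : B.IsSymm) (hn : B.Nondegenerate) :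
    PolarSpace F V where
  σ := σ
  B := B
  Singular v := B v v = 0
  zero := map_zero (B 0)
  refl := hB.isRefl
  self _ h := h
  comb a b x y hx hy h := by
    simp [hx, hy, h, hB.isRefl _ _ h]
  hyperbolic v w hv h := by
    obtain ⟨a, ha⟩ := exists_add_apply_eq hr hσ (b := -B w w) (by rw [map_neg, hB.eq])
    have h1 : B w v ≠ 0 := fun h1 => h (hB.isRefl _ _ h1)
    refine ⟨a / B w v, ?_⟩
    have h2 : B (w + (a / B w v) • v) (w + (a / B w v) • v) =
        B w w + a / B w v * B w v + σ a / σ (B w v) * B v w := by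
      simp only [map_add, LinearMap.map_smulₛₗ, LinearMap.add_apply, LinearMap.smul_apply,
        smul_eq_mul, hv, RingHom.id_apply, map_div₀]
      ring
    rw [h2, hB.eq, div_mul_cancel₀ _ h1, div_mul_cancel₀ _ h, add_assoc, ha, add_neg_cancel]
  radical v _ h := hn.1 v h

end PolarSpace

/-- With m the dimension of a maximal isotropic subspace, 2m ≤ dim V < 2m + k, where k = 1, 3, 2 in
the symplectic, quadratic and Hermitian case. This determines m except for quadratic forms in even
dimension, where the Witt index is given. -/
theorem PolarForm.IsDualPolar.exists_polarSpace {F V : Type*} [Field F] [Finite F]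
    [AddCommGroup V] [Module F V] [FiniteDimensional F V] [Finite V] {d : ℕ} {ω : PolarForm F V}
    (hω : ω.IsDualPolar d) :
    ∃ P : PolarSpace F V, ω.IsIsotropic = P.Iso ∧ ∀ x, Maximal P.Iso x → finrank F x = d := by
  match ω, hω with
  | .symplectic B, ⟨hB, hn, hd⟩ =>
    refine ⟨PolarSpace.ofSymplectic B hB hn, ?_, fun x hx => ?_⟩
    · ext u
      exact ⟨fun h => ⟨fun _ _ => trivial, h⟩, fun h => h.2⟩
    · have h1 := PolarSpace.two_mul_finrank_le hx
      have h2 := PolarSpace.finrank_lt_two_mul_finrank_add (k := 1) (fun c hc => by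
        obtain ⟨v, hv, hv0⟩ := exists_mem_notMem_of_finrank_lt (F := F) (a := ⊥) (b := c)
          (by rw [finrank_bot]; omega)
        exact ⟨v, hv, fun h => hv0 (by simp [h]), trivial⟩) hx
      omega
  | .quadratic Q, ⟨hQ, hd⟩ =>
    have hiso : (PolarForm.quadratic Q).IsIsotropic = (PolarSpace.ofQuadratic Q hQ).Iso := by
      ext u
      refine ⟨fun h => ⟨h, fun x hx y hy => ?_⟩, fun h => h.1⟩
      have h1 : ∀ x ∈ u, Q x = 0 := h
      change Q (x + y) - Q x - Q y = 0
      rw [h1 _ (u.add_mem hx hy), h1 x hx, h1 y hy, sub_zero, sub_zero]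
    refine ⟨PolarSpace.ofQuadratic Q hQ, hiso, fun x hx => ?_⟩
    have hwitt : (PolarForm.quadratic Q).HasWittIndex d → finrank F x = d := by
      rintro ⟨⟨u, hu, hud⟩, hmax⟩
      refine le_antisymm (hmax ⟨x, by rw [hiso]; exact hx.1, rfl⟩) ?_
      rw [← hud]
      rw [hiso] at hu
      exact PolarSpace.finrank_le_of_maximal hu hx
    rcases hd with hd | hd | hd
    · have h1 := PolarSpace.two_mul_finrank_le hx
      have h2 := PolarSpace.finrank_lt_two_mul_finrank_add (k := 3) (fun c hc => by
        obtain ⟨v, hv0, hv⟩ := QuadraticForm.exists_ne_zero_eq_zero (Q.comp c.subtype) hc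
        exact ⟨v, v.2, fun h => hv0 (Subtype.ext h), hv⟩) hx
      omega
    · exact hwitt hd.2
    · exact hwitt hd.2
  | .hermitian σ B, ⟨⟨r, hr, hσ⟩, hB, hn, hd⟩ =>
    refine ⟨PolarSpace.ofHermitian hr hσ B hB hn, ?_, fun x hx => ?_⟩
    · ext u
      exact ⟨fun h => ⟨fun x hx => h x hx x hx, h⟩, fun h => h.2⟩
    · have h1 := PolarSpace.two_mul_finrank_le hx
      have h2 := PolarSpace.finrank_lt_two_mul_finrank_add (k := 2)
        (fun c hc => hB.exists_ne_zero_eq_zero hr hσ c hc) hx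
      omega

/-! ### Regularity and distances in the dual polar graph -/

namespace PolarForm

section Regular

variable {F V : Type*} [Field F] [AddCommGroup V] [Module F V]

/-- The geometric facts about a polar space of rank `d` and order `t` from which the spectrum of
its dual polar graph is computed. -/
structure IsRegular (ω : PolarForm F V) (d t : ℕ) : Prop where
  mono : ∀ {u w : Submodule F V}, u ≤ w → ω.IsIsotropic w → ω.IsIsotropic u
  bot : ω.IsIsotropic ⊥
  exists_vertex_ge : ∀ {u}, ω.IsIsotropic u → ∃ x : ω.Vertex, u ≤ x.1
  finrank_vertex : ∀ x : ω.Vertex, finrank F x.1 = d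
  maximal_of_finrank : ∀ {u}, ω.IsIsotropic u → finrank F u = d → Maximal ω.IsIsotropic u
  exists_adj : ∀ (x : ω.Vertex) {u}, ω.IsIsotropic u → ¬ u ≤ x.1 → ∃ y, (ω.graph d).Adj x y ∧
    finrank F (x.1 ⊓ u : Submodule F V) < finrank F (y.1 ⊓ u : Submodule F V)
  finrank_inf_le : ∀ {x y : ω.Vertex}, (ω.graph d).Adj x y → ∀ u : Submodule F V,
    finrank F (y.1 ⊓ u : Submodule F V) ≤ finrank F (x.1 ⊓ u : Submodule F V) + 1
  existsUnique_adj : ∀ (x : ω.Vertex) {u}, ω.IsIsotropic u →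
    finrank F (x.1 ⊓ u : Submodule F V) + 1 = finrank F u → ∃! y, (ω.graph d).Adj x y ∧ u ≤ y.1
  exists_disjoint : ∀ {u}, ω.IsIsotropic u → ∃ x : ω.Vertex, x.1 ⊓ u = ⊥
  order_pos : 0 < t
  card_vertex_ge : ∀ {h}, ω.IsIsotropic h → finrank F h + 1 = d →
    Nat.card {x : ω.Vertex // h ≤ x.1} = t + 1

theorem IsDualPolar.exists_isRegular [Finite F] [FiniteDimensional F V] [Finite V] {d : ℕ}
    {ω : PolarForm F V} (hω : ω.IsDualPolar d) : ∃ t, ω.IsRegular d t := by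
  obtain ⟨P, hP, hd⟩ := hω.exists_polarSpace
  obtain ⟨t, ht0, ht⟩ := PolarSpace.exists_order hd
  have hmax : ∀ x : ω.Vertex, Maximal P.Iso x.1 := fun x => hP ▸ x.2
  have hadj : ∀ {x y : ω.Vertex}, (ω.graph d).Adj x y ↔
      finrank F (x.1 ⊓ y.1 : Submodule F V) + 1 = d := by
    intro x y
    refine ⟨fun h => h.2, fun h => ⟨?_, h⟩⟩
    rintro rfl
    rw [inf_idem, hd x.1 (hmax x)] at h
    omega
  let mk : ∀ y, Maximal P.Iso y → ω.Vertex := fun y hy => ⟨y, hP ▸ hy⟩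
  refine ⟨t, ⟨fun h hw => ?_, ?_, fun hu => ?_, fun x => hd x.1 (hmax x), fun hu h => ?_,
    fun x u hu hux => ?_, fun {x y} h u => PolarSpace.finrank_inf_le_of_adj hd (hmax y) h.2 u,
    fun x u hu h => ?_, fun hu => ?_, ht0, fun {h} hi hh => ?_⟩⟩
  · rw [hP] at hw ⊢
    exact hw.mono h
  · rw [hP]
    exact PolarSpace.iso_bot
  · rw [hP] at hu
    obtain ⟨x, hux, hx⟩ := PolarSpace.exists_maximal_ge hu
    exact ⟨mk x hx, hux⟩
  · rw [hP] at hu ⊢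
    exact PolarSpace.maximal_of_finrank hd hu h
  · rw [hP] at hu
    obtain ⟨y, hy, h1, h2⟩ := PolarSpace.exists_adj_finrank_inf_lt hd (hmax x) hu hux
    exact ⟨mk y hy, hadj.2 h1, h2⟩
  · rw [hP] at hu
    obtain ⟨y, ⟨hy, h1, h2⟩, h3⟩ := PolarSpace.existsUnique_adj_ge hd (hmax x) hu h
    exact ⟨mk y hy, ⟨hadj.2 h1, h2⟩, fun z hz => Subtype.ext (h3 z.1 ⟨hmax z, hz.1.2, hz.2⟩)⟩
  · rw [hP] at hu
    obtain ⟨y, hy, h⟩ := PolarSpace.exists_maximal_disjoint hd hu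
    exact ⟨mk y hy, h⟩
  · rw [hP] at hi
    rw [← ht h hi hh]
    exact Nat.card_congr ⟨fun x => ⟨x.1.1, hmax x.1, x.2⟩, fun x => ⟨mk x.1 x.2.1, x.2.2⟩,
      fun _ => rfl, fun _ => rfl⟩

variable {ω : PolarForm F V} {d t : ℕ}

theorem IsRegular.finrank_le [FiniteDimensional F V] (h : ω.IsRegular d t) {u : Submodule F V}
    (hu : ω.IsIsotropic u) : finrank F u ≤ d := by
  obtain ⟨x, hx⟩ := h.exists_vertex_ge hu
  exact (Submodule.finrank_mono hx).trans (h.finrank_vertex x).le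

theorem IsRegular.exists_walk [FiniteDimensional F V] (h : ω.IsRegular d t) (x y : ω.Vertex) :
    ∃ p : (ω.graph d).Walk x y,
      p.length + finrank F (x.1 ⊓ y.1 : Submodule F V) ≤ d := by
  generalize hn : d - finrank F (x.1 ⊓ y.1 : Submodule F V) = n
  induction n using Nat.strong_induction_on generalizing x with
  | _ n ih =>
    have hle : ∀ z : ω.Vertex, finrank F (z.1 ⊓ y.1 : Submodule F V) ≤ d := fun z =>
      h.finrank_le (h.mono inf_le_right y.2.1)
    by_cases hyx : y.1 ≤ x.1
    · have hxy : x = y := Subtype.ext (le_antisymm (y.2.2 x.2.1 hyx) hyx)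
      subst hxy
      exact ⟨.nil, by simpa using hle x⟩
    · obtain ⟨z, hz, h1⟩ := h.exists_adj x y.2.1 hyx
      have h2 := hle z
      obtain ⟨p, hp⟩ := ih _ (by omega) z rfl
      exact ⟨.cons hz p, by rw [SimpleGraph.Walk.length_cons]; omega⟩

theorem IsRegular.le_length_add (h : ω.IsRegular d t) {x y : ω.Vertex}
    (p : (ω.graph d).Walk x y) : d ≤ p.length + finrank F (x.1 ⊓ y.1 : Submodule F V) := by
  induction p with
  | nil => rw [inf_idem, h.finrank_vertex]; exact Nat.le_add_left _ _
  | @cons x z y hz p ih =>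
    have h1 := h.finrank_inf_le hz y.1
    rw [SimpleGraph.Walk.length_cons]
    omega

theorem IsRegular.dist_add_finrank_inf [FiniteDimensional F V] (h : ω.IsRegular d t)
    (x y : ω.Vertex) :
    (ω.graph d).dist x y + finrank F (x.1 ⊓ y.1 : Submodule F V) = d := by
  obtain ⟨p, hp⟩ := h.exists_walk x y
  obtain ⟨p', hp'⟩ := p.reachable.exists_walk_length_eq_dist
  have h1 := h.le_length_add p'
  have h2 := SimpleGraph.dist_le p
  omega

end Regular

/-! ### Counting isotropic subspaces and neighbours -/

section Finite

variable {F V : Type*} [Field F] [Finite F] [AddCommGroup V] [Module F V]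
  [FiniteDimensional F V] {ω : PolarForm F V} {d t : ℕ}

theorem IsRegular.card_isotropic_between (h : ω.IsRegular d t) {w s : Submodule F V}
    (hws : w ≤ s) (hs : ω.IsIsotropic s) {k : ℕ} (hk : finrank F w ≤ k) :
    (Nat.card {u : ω.Isotropic k // w ≤ u.1 ∧ u.1 ≤ s} : ℝ) =
      gaussBinom (Nat.card F) (finrank F s - finrank F w) (k - finrank F w) := by
  rw [← card_submodule_between hws hk]
  congr 1
  exact Nat.card_congr ⟨fun u => ⟨u.1.1, u.2.1, u.2.2, u.1.2.2⟩,
    fun u => ⟨⟨u.1, h.mono u.2.2.1 hs, u.2.2.2⟩, u.2.1, u.2.2.1⟩, fun _ => rfl, fun _ => rfl⟩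

theorem IsRegular.card_isotropic_le (h : ω.IsRegular d t) {s : Submodule F V}
    (hs : ω.IsIsotropic s) (k : ℕ) :
    (Nat.card {u : ω.Isotropic k // u.1 ≤ s} : ℝ) = gaussBinom (Nat.card F) (finrank F s) k := by
  have h1 := h.card_isotropic_between bot_le hs (k := k) (by simp)
  simpa using h1

variable [Finite V]

/-- Sort the neighbours y by the hyperplane x ∩ y of x. The hyperplanes containing u number [d - dim
u], and each lies in t vertices other than x. -/
theorem IsRegular.card_adj_ge (h : ω.IsRegular d t) (x : ω.Vertex) {u : Submodule F V}
    (hux : u ≤ x.1) :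
    (Nat.card {y : ω.Vertex // (ω.graph d).Adj x y ∧ u ≤ y.1} : ℝ) =
      t * (((Nat.card F : ℝ) ^ (d - finrank F u) - 1) / ((Nat.card F : ℝ) - 1)) := by
  have hq : 1 < Nat.card F := Finite.one_lt_card
  have hud := Submodule.finrank_mono hux
  rw [h.finrank_vertex x] at hud
  rcases hud.eq_or_lt with hud | hud
  · have : IsEmpty {y : ω.Vertex // (ω.graph d).Adj x y ∧ u ≤ y.1} := by
      refine ⟨fun y => y.2.1.1 (Subtype.ext ?_)⟩
      have h1 : u = x.1 :=
        Submodule.eq_of_le_of_finrank_eq hux (by rw [hud, h.finrank_vertex x])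
      have h2 : x.1 ≤ y.1.1 := h1.ge.trans y.2.2
      exact Submodule.eq_of_le_of_finrank_eq h2 (by rw [h.finrank_vertex, h.finrank_vertex])
    rw [Nat.card_of_isEmpty, hud]
    simp
  · let H := {w : Submodule F V // u ≤ w ∧ w ≤ x.1 ∧ finrank F w = d - 1}
    have hH : (Nat.card H : ℝ) =
        ((Nat.card F : ℝ) ^ (d - finrank F u) - 1) / ((Nat.card F : ℝ) - 1) := by
      rw [card_submodule_between hux (by omega), h.finrank_vertex,
        show d - finrank F u = (d - 1 - finrank F u) + 1 by omega, gaussBinom_succ_self hq]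
    have := Fintype.ofFinite H
    let f : {y : ω.Vertex // (ω.graph d).Adj x y ∧ u ≤ y.1} → H := fun y =>
      ⟨x.1 ⊓ y.1.1, le_inf hux y.2.2, inf_le_left, by have := y.2.1.2; omega⟩
    have hfib : ∀ w : H, Nat.card {y // f y = w} = t := by
      intro w
      have h1 := h.card_vertex_ge (h.mono w.2.2.1 x.2.1) (by rw [w.2.2.2]; omega)
      have h2 : Nat.card {y // f y = w} + 1 = Nat.card {y : ω.Vertex // w.1 ≤ y.1} := by
        -- The added element stands for x itself among the t + 1 vertices over w.
        rw [← Finite.card_option]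
        have hxw : ∀ y : ω.Vertex, w.1 ≤ y.1 → y ≠ x → x.1 ⊓ y.1 = w.1 := by
          intro y hy hyx
          symm
          refine Submodule.eq_of_le_of_finrank_le (le_inf w.2.2.1 hy) ?_
          rw [w.2.2.2]
          have h3 : x.1 ⊓ y.1 < x.1 := lt_of_le_of_ne inf_le_left fun h4 => hyx (Subtype.ext
            (Submodule.eq_of_le_of_finrank_eq (inf_eq_left.1 h4)
              (by rw [h.finrank_vertex, h.finrank_vertex])).symm)
          have h4 := Submodule.finrank_lt_finrank_of_lt h3
          rw [h.finrank_vertex] at h4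
          omega
        refine Nat.card_congr (Equiv.ofBijective (fun o => o.elim ⟨x, w.2.2.1⟩
          fun y => ⟨y.1.1, (congrArg Subtype.val y.2).ge.trans inf_le_right⟩) ⟨?_, ?_⟩)
        · rintro (_ | a) (_ | b) hab
          · rfl
          · exact (b.1.2.1.1 (congrArg Subtype.val hab)).elim
          · exact (a.1.2.1.1 (congrArg Subtype.val hab).symm).elim
          · have h3 := congrArg (fun z : {y : ω.Vertex // w.1 ≤ y.1} => z.1) hab
            exact congrArg some (Subtype.ext (Subtype.ext h3))
        · intro y
          by_cases hyx : y.1 = x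
          · exact ⟨none, Subtype.ext hyx.symm⟩
          · have h3 := hxw y.1 y.2 hyx
            refine ⟨some ⟨⟨y.1, ⟨fun h => hyx h.symm, ?_⟩, w.2.1.trans y.2⟩,
              Subtype.ext h3⟩, rfl⟩
            rw [h3, w.2.2.2]
            omega
      omega
    rw [← hH, ← Nat.card_congr (Equiv.sigmaFiberEquiv f), Nat.card_sigma,
      Finset.sum_congr rfl fun w _ => hfib w, Finset.sum_const, Finset.card_univ, smul_eq_mul,
      Nat.card_eq_fintype_card]
    push_cast
    ring

end Finite

end PolarForm

/-- The `q`-integer `[m]_q`, as a real number. -/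
noncomputable def qInt (q m : ℕ) : ℝ := ((q : ℝ) ^ m - 1) / ((q : ℝ) - 1)

theorem qInt_zero (q : ℕ) : qInt q 0 = 0 := by simp [qInt]

theorem qInt_strictMono {q : ℕ} (hq : 1 < q) : StrictMono (qInt q) := fun m n hmn => by
  have h1 : (1 : ℝ) < q := by exact_mod_cast hq
  exact div_lt_div_of_pos_right (sub_lt_sub_right (pow_lt_pow_right₀ h1 hmn) 1) (sub_pos.2 h1)

theorem qInt_pos {q : ℕ} (hq : 1 < q) {m : ℕ} (hm : 0 < m) : 0 < qInt q m :=
  qInt_zero q ▸ qInt_strictMono hq hm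

/-- The eigenvalues of the dual polar graph of diameter `d` and order `t` over `𝔽_q`. -/
noncomputable def dualPolarEigenvalue (q d t j : ℕ) : ℝ := t * qInt q (d - j) - qInt q j

theorem dualPolarEigenvalue_lt {q d t : ℕ} (hq : 1 < q) {j k : ℕ} (hjk : j < k) :
    dualPolarEigenvalue q d t k < dualPolarEigenvalue q d t j := by
  rw [dualPolarEigenvalue, dualPolarEigenvalue, sub_eq_add_neg, sub_eq_add_neg]
  exact add_lt_add_of_le_of_lt (mul_le_mul_of_nonneg_left ((qInt_strictMono hq).monotone
    (Nat.sub_le_sub_left hjk.le d)) t.cast_nonneg) (neg_lt_neg (qInt_strictMono hq hjk))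

/-! ### The adjacency matrix on indicator functions -/

namespace PolarForm

variable {F V : Type*} [Field F] [AddCommGroup V] [Module F V]
  {ω : PolarForm F V} {d t : ℕ}

open scoped Classical in
theorem iota_apply (u : Submodule F V) (x : ω.Vertex) :
    ω.iota u x = if u ≤ x.1 then 1 else 0 := rfl

variable [Finite V]

theorem inner_eq_sum (f g : EuclideanSpace ℝ ω.Vertex) : inner ℝ f g = ∑ x, f x * g x := by
  simp [PiLp.inner_apply, mul_comm]

open scoped Classical in
theorem toEuclideanLin_distMatrix_one_apply (f : EuclideanSpace ℝ ω.Vertex) (x : ω.Vertex) :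
    (distMatrix (ω.graph d) 1).toEuclideanLin f x = ∑ y with (ω.graph d).Adj x y, f y := by
  rw [Finset.sum_filter]
  simp [distMatrix, Matrix.toLpLin_apply, Matrix.mulVec, dotProduct,
    SimpleGraph.dist_eq_one_iff_adj]

theorem toEuclideanLin_distMatrix_isSymmetric (i : ℕ) :
    (distMatrix (ω.graph d) i).toEuclideanLin.IsSymmetric := by
  refine Matrix.isSymmetric_toEuclideanLin_iff.2 ?_
  ext x y
  simp [distMatrix, SimpleGraph.dist_comm]

theorem toEuclideanLin_matU (j : ℕ) (f : EuclideanSpace ℝ ω.Vertex) :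
    (ω.matU j).toEuclideanLin f =
      ∑ u : ω.Isotropic j, inner ℝ (ω.iota u.1) f • ω.iota u.1 := by
  ext x
  simp only [matU, Matrix.toLpLin_apply, Matrix.mulVec, dotProduct, Matrix.of_apply, inner_eq_sum,
    WithLp.ofLp_sum, Finset.sum_apply, PiLp.smul_apply, smul_eq_mul, Finset.sum_mul]
  rw [Finset.sum_comm]
  exact Finset.sum_congr rfl fun u _ => Finset.sum_congr rfl fun y _ => by ring

open scoped Classical in
theorem natCard_eq_sum {α : Type*} [Fintype α] (p : α → Prop) :
    (Nat.card {a // p a} : ℝ) = ∑ a, if p a then 1 else 0 := by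
  rw [Nat.card_eq_fintype_card, Fintype.card_subtype, Finset.sum_boole]

open scoped Classical in
theorem adj_iota_apply (x : ω.Vertex)
    (u : Submodule F V) :
    (distMatrix (ω.graph d) 1).toEuclideanLin (ω.iota u) x =
      Nat.card {y : ω.Vertex // (ω.graph d).Adj x y ∧ u ≤ y.1} := by
  rw [toEuclideanLin_distMatrix_one_apply, natCard_eq_sum, Finset.sum_filter]
  refine Finset.sum_congr rfl fun y _ => ?_
  by_cases h1 : (ω.graph d).Adj x y <;> by_cases h2 : u ≤ y.1 <;> simp [iota_apply, h1, h2]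

variable [Finite F]

theorem IsRegular.matU_apply [FiniteDimensional F V] (h : ω.IsRegular d t) (j : ℕ)
    (x y : ω.Vertex) :
    ω.matU j x y = gaussBinom (Nat.card F) (finrank F (x.1 ⊓ y.1 : Submodule F V)) j := by
  classical
  rw [← h.card_isotropic_le (h.mono inf_le_left x.2.1), natCard_eq_sum]
  refine Finset.sum_congr rfl fun u _ => ?_
  by_cases h1 : u.1 ≤ x.1 <;> by_cases h2 : u.1 ≤ y.1 <;> simp [iota_apply, h1, h2]

theorem IsRegular.adj_iota_zero [FiniteDimensional F V] (h : ω.IsRegular d t)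
    (u : ω.Isotropic 0) :
    (distMatrix (ω.graph d) 1).toEuclideanLin (ω.iota u.1) =
      dualPolarEigenvalue (Nat.card F) d t 0 • ω.iota u.1 := by
  ext x
  have hu : u.1 ≤ x.1 := by rw [Submodule.finrank_eq_zero.1 u.2.2]; exact bot_le
  rw [adj_iota_apply, h.card_adj_ge x hu, PiLp.smul_apply, iota_apply, if_pos hu, u.2.2,
    dualPolarEigenvalue, qInt_zero, qInt]
  simp

open scoped Classical in
theorem IsRegular.sum_iota_le_apply [FiniteDimensional F V] (h : ω.IsRegular d t) {j : ℕ}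
    (u : Submodule F V) (x : ω.Vertex) :
    (∑ w : ω.Isotropic j with w.1 ≤ u, ω.iota w.1) x =
      gaussBinom (Nat.card F) (finrank F (x.1 ⊓ u : Submodule F V)) j := by
  rw [← h.card_isotropic_le (h.mono inf_le_left x.2.1), natCard_eq_sum, WithLp.ofLp_sum,
    Finset.sum_apply, Finset.sum_filter]
  refine Finset.sum_congr rfl fun w _ => ?_
  rw [iota_apply, ← ite_and]
  exact if_congr (by rw [le_inf_iff, and_comm]) rfl rfl

-- Both sides at x depend only on dim(x ∩ u). If u ⊆ x, there are t[d-j-1] neighbours over u, and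
-- the [j+1] hyperplanes of u cancel the negative part of the eigenvalue. If dim(x ∩ u) = j, there
-- is one neighbour and one hyperplane. Below that there are none.
open scoped Classical in
theorem IsRegular.adj_iota_succ [FiniteDimensional F V] (h : ω.IsRegular d t) {j : ℕ}
    (u : ω.Isotropic (j + 1)) :
    (distMatrix (ω.graph d) 1).toEuclideanLin (ω.iota u.1) =
      dualPolarEigenvalue (Nat.card F) d t (j + 1) • ω.iota u.1 +
        ∑ w : ω.Isotropic j with w.1 ≤ u.1, ω.iota w.1 := by
  have hq : 1 < Nat.card F := Finite.one_lt_card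
  ext x
  rw [adj_iota_apply, PiLp.add_apply, PiLp.smul_apply, h.sum_iota_le_apply, iota_apply]
  split_ifs with hu
  · rw [h.card_adj_ge x hu, inf_eq_right.2 hu, u.2.2, gaussBinom_succ_self hq,
      dualPolarEigenvalue, qInt, qInt]
    simp
  · have h1 : finrank F (x.1 ⊓ u.1 : Submodule F V) < j + 1 :=
      (Submodule.finrank_lt_finrank_of_lt
        (lt_of_le_of_ne inf_le_right fun h => hu (inf_eq_right.1 h))).trans_eq u.2.2
    rw [smul_zero, zero_add]
    rcases (Nat.lt_succ_iff.1 h1).eq_or_lt with h2 | h2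
    · rw [h2, gaussBinom_self hq]
      obtain ⟨y, hy, hy'⟩ := h.existsUnique_adj x u.2.1 (by rw [h2, u.2.2])
      have : Unique {y : ω.Vertex // (ω.graph d).Adj x y ∧ u.1 ≤ y.1} :=
        ⟨⟨⟨y, hy⟩⟩, fun z => Subtype.ext (hy' z.1 z.2)⟩
      rw [Nat.card_unique, Nat.cast_one]
    · rw [gaussBinom_eq_zero_of_lt h2]
      have : IsEmpty {y : ω.Vertex // (ω.graph d).Adj x y ∧ u.1 ≤ y.1} := ⟨fun y => by
        have h3 := h.finrank_inf_le y.2.1 u.1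
        rw [inf_eq_right.2 y.2.2, u.2.2] at h3
        omega⟩
      rw [Nat.card_of_isEmpty, Nat.cast_zero]

open scoped Classical in
theorem IsRegular.sum_iota_ge [FiniteDimensional F V] (h : ω.IsRegular d t) {j : ℕ}
    (w : ω.Isotropic j) :
    ∑ u : ω.Isotropic (j + 1) with w.1 ≤ u.1, ω.iota u.1 =
      qInt (Nat.card F) (d - j) • ω.iota w.1 := by
  have hq : 1 < Nat.card F := Finite.one_lt_card
  ext x
  have h1 : (∑ u : ω.Isotropic (j + 1) with w.1 ≤ u.1, ω.iota u.1) x =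
      (Nat.card {u : ω.Isotropic (j + 1) // w.1 ≤ u.1 ∧ u.1 ≤ x.1} : ℝ) := by
    rw [natCard_eq_sum, WithLp.ofLp_sum, Finset.sum_apply, Finset.sum_filter]
    refine Finset.sum_congr rfl fun u _ => ?_
    by_cases h1 : w.1 ≤ u.1 <;> by_cases h2 : u.1 ≤ x.1 <;> simp [iota_apply, h1, h2]
  rw [h1, PiLp.smul_apply, iota_apply]
  split_ifs with hw
  · rw [h.card_isotropic_between hw x.2.1 (by rw [w.2.2]; omega), w.2.2, h.finrank_vertex,
      Nat.add_sub_cancel_left, gaussBinom_one_right hq, qInt]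
    simp
  · have : IsEmpty {u : ω.Isotropic (j + 1) // w.1 ≤ u.1 ∧ u.1 ≤ x.1} :=
      ⟨fun u => hw (u.2.1.trans u.2.2)⟩
    simp

end PolarForm

/-! ### The flag of the Λ_j, the spectrum and the frame constant -/

namespace PolarForm

variable {F V : Type*} [Field F] [AddCommGroup V] [Module F V]
  {ω : PolarForm F V} {d t : ℕ}

theorem iota_mem_Lam {j : ℕ} (u : ω.Isotropic j) : ω.iota u.1 ∈ ω.Lam j :=
  Submodule.subset_span ⟨u, rfl⟩

theorem IsRegular.nonempty_isotropic (h : ω.IsRegular d t) {j : ℕ} (hj : j ≤ d) : Nonempty (ω.Isotropic j) := by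
  obtain ⟨x, -⟩ := h.exists_vertex_ge h.bot
  obtain ⟨b, hb⟩ := exists_linearIndependent_of_le_finrank (R := F) (M := x.1)
    (hj.trans (h.finrank_vertex x).ge)
  refine ⟨⟨(Submodule.span F (Set.range b)).map x.1.subtype,
    h.mono (Submodule.map_subtype_le _ _) x.2.1, ?_⟩⟩
  rw [Submodule.finrank_map_subtype_eq, finrank_span_eq_card hb, Fintype.card_fin]

variable [Finite V]

theorem eigenV_le_Lam (j : ℕ) : ω.eigenV j ≤ ω.Lam j := by
  cases j with
  | zero => exact le_rfl
  | succ j => exact inf_le_left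

theorem matU_mem_Lam (j : ℕ) (f : EuclideanSpace ℝ ω.Vertex) :
    (ω.matU j).toEuclideanLin f ∈ ω.Lam j := by
  rw [toEuclideanLin_matU]
  exact sum_mem fun u _ => Submodule.smul_mem _ _ (iota_mem_Lam u)

theorem inner_matU (j : ℕ) (f : EuclideanSpace ℝ ω.Vertex) :
    inner ℝ f ((ω.matU j).toEuclideanLin f) = ∑ u : ω.Isotropic j, inner ℝ f (ω.iota u.1) ^ 2 := by
  rw [toEuclideanLin_matU, inner_sum]
  exact Finset.sum_congr rfl fun u _ => by
    rw [real_inner_smul_right, real_inner_comm, sq]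

theorem eq_zero_of_mem_eigenV {j : ℕ} {f : EuclideanSpace ℝ ω.Vertex} (hf : f ∈ ω.eigenV j)
    (h : ∀ u : ω.Isotropic j, inner ℝ f (ω.iota u.1) = 0) : f = 0 := by
  have h1 : ω.Lam j ≤ (Submodule.span ℝ {f})ᗮ := Submodule.span_le.2 <| by
    rintro _ ⟨u, rfl⟩
    exact Submodule.mem_orthogonal_singleton_iff_inner_right.2 (h u)
  exact (inner_self_eq_zero (𝕜 := ℝ)).1
    (Submodule.mem_orthogonal_singleton_iff_inner_right.1 (h1 (eigenV_le_Lam j hf)))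

variable [Finite F] [FiniteDimensional F V]

namespace IsRegular

variable (h : ω.IsRegular d t)
include h

theorem Lam_le_succ {j : ℕ} (hj : j < d) : ω.Lam j ≤ ω.Lam (j + 1) := by
  classical
  refine Submodule.span_le.2 ?_
  rintro _ ⟨w, rfl⟩
  have h1 := (qInt_pos (Finite.one_lt_card (α := F)) (Nat.sub_pos_of_lt hj)).ne'
  have h2 : qInt (Nat.card F) (d - j) • ω.iota w.1 ∈ ω.Lam (j + 1) := by
    rw [← h.sum_iota_ge w]
    exact sum_mem fun u _ => iota_mem_Lam u
  exact (Submodule.smul_mem_iff _ h1).1 h2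

theorem Lam_mono {i j : ℕ} (hij : i ≤ j) (hj : j ≤ d) : ω.Lam i ≤ ω.Lam j := by
  induction j, hij using Nat.le_induction with
  | base => exact le_rfl
  | succ j hij ih => exact (ih (by omega)).trans (h.Lam_le_succ (by omega))

theorem adj_Lam_zero {f : EuclideanSpace ℝ ω.Vertex} (hf : f ∈ ω.Lam 0) :
    (distMatrix (ω.graph d) 1).toEuclideanLin f =
      dualPolarEigenvalue (Nat.card F) d t 0 • f := by
  induction hf using Submodule.span_induction with
  | mem f hf =>
    obtain ⟨u, rfl⟩ := hf
    exact h.adj_iota_zero u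
  | zero => simp
  | add f g _ _ hf hg => rw [map_add, hf, hg, smul_add]
  | smul a f _ hf => rw [map_smul, hf, smul_comm]

theorem adj_Lam_succ {j : ℕ} {f : EuclideanSpace ℝ ω.Vertex} (hf : f ∈ ω.Lam (j + 1)) :
    (distMatrix (ω.graph d) 1).toEuclideanLin f -
      dualPolarEigenvalue (Nat.card F) d t (j + 1) • f ∈ ω.Lam j := by
  classical
  induction hf using Submodule.span_induction with
  | mem f hf =>
    obtain ⟨u, rfl⟩ := hf
    rw [h.adj_iota_succ u, add_sub_cancel_left]
    exact sum_mem fun w _ => iota_mem_Lam w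
  | zero => simp
  | add f g _ _ hf hg =>
    rw [map_add, smul_add, add_sub_add_comm]
    exact add_mem hf hg
  | smul a f _ hf =>
    rw [map_smul, smul_comm, ← smul_sub]
    exact Submodule.smul_mem _ a hf

theorem adj_mem_Lam {j : ℕ} (hj : j ≤ d) {f : EuclideanSpace ℝ ω.Vertex} (hf : f ∈ ω.Lam j) :
    (distMatrix (ω.graph d) 1).toEuclideanLin f ∈ ω.Lam j := by
  cases j with
  | zero =>
    rw [h.adj_Lam_zero hf]
    exact Submodule.smul_mem _ _ hf
  | succ j =>
    have h1 := add_mem (h.Lam_le_succ (Nat.lt_of_succ_le hj) (h.adj_Lam_succ hf))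
      (Submodule.smul_mem _ (dualPolarEigenvalue (Nat.card F) d t (j + 1)) hf)
    rwa [sub_add_cancel] at h1

/-- The error g = A_1 f - θf lies in the A_1-invariant lower layer, to which f is orthogonal.
Self-adjointness gives ⟨g, g⟩ = ⟨f, A_1 g⟩ - θ⟨f, g⟩ = 0. -/
theorem adj_eigenV {j : ℕ} (hj : j ≤ d) {f : EuclideanSpace ℝ ω.Vertex} (hf : f ∈ ω.eigenV j) :
    (distMatrix (ω.graph d) 1).toEuclideanLin f =
      dualPolarEigenvalue (Nat.card F) d t j • f := by
  cases j with
  | zero => exact h.adj_Lam_zero hf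
  | succ j =>
    have h1 := h.adj_Lam_succ hf.1
    have h2 := h.adj_mem_Lam (Nat.le_of_succ_le hj) h1
    refine sub_eq_zero.1 ((inner_self_eq_zero (𝕜 := ℝ)).1 ?_)
    nth_rw 1 [inner_sub_left]
    rw [toEuclideanLin_distMatrix_isSymmetric, real_inner_smul_left, real_inner_comm,
      (Submodule.mem_orthogonal _ _).1 hf.2 _ h2, real_inner_comm,
      (Submodule.mem_orthogonal _ _).1 hf.2 _ h1, mul_zero, sub_zero]

theorem matU_self : ω.matU d = 1 := by
  have hq : 1 < Nat.card F := Finite.one_lt_card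
  ext x y
  rw [h.matU_apply]
  by_cases hxy : x = y
  · subst hxy
    rw [inf_idem, h.finrank_vertex, gaussBinom_self hq, Matrix.one_apply_eq]
  · rw [Matrix.one_apply_ne hxy]
    refine gaussBinom_eq_zero_of_lt ?_
    rw [← h.finrank_vertex x]
    exact Submodule.finrank_lt_finrank_of_lt (lt_of_le_of_ne inf_le_left fun h1 =>
      hxy (Subtype.ext (Submodule.eq_of_le_of_finrank_eq (inf_eq_left.1 h1)
        (by rw [h.finrank_vertex, h.finrank_vertex]))))

theorem Lam_eq_top : ω.Lam d = ⊤ := by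
  refine Submodule.eq_top_iff'.2 fun f => ?_
  have h1 := matU_mem_Lam (ω := ω) d f
  rwa [h.matU_self, Matrix.toLpLin_one, LinearMap.id_apply] at h1

theorem Lam_le_iSup_eigenV {j : ℕ} (hj : j ≤ d) :
    ω.Lam j ≤ ⨆ i : Fin (d + 1), ω.eigenV i := by
  induction j with
  | zero => exact le_iSup (fun i : Fin (d + 1) => ω.eigenV i) 0
  | succ j ih =>
    rw [← Submodule.sup_orthogonal_inf_of_hasOrthogonalProjection
      (h.Lam_le_succ (Nat.lt_of_succ_le hj)), inf_comm]
    exact sup_le (ih (by omega))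
      (le_iSup (fun i : Fin (d + 1) => ω.eigenV i) ⟨j + 1, by omega⟩)

theorem inner_eigenV_eq_zero {i j : ℕ} (hij : i < j) (hj : j ≤ d)
    {f g : EuclideanSpace ℝ ω.Vertex} (hf : f ∈ ω.eigenV i) (hg : g ∈ ω.eigenV j) :
    inner ℝ f g = 0 := by
  obtain ⟨j, rfl⟩ : ∃ k, j = k + 1 := ⟨j - 1, by omega⟩
  exact (Submodule.mem_orthogonal _ _).1 hg.2 _
    (h.Lam_mono (Nat.le_of_lt_succ hij) (by omega) (eigenV_le_Lam i hf))

theorem isInternal_eigenV : DirectSum.IsInternal fun j : Fin (d + 1) => ω.eigenV j := by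
  have horth : OrthogonalFamily ℝ (fun j : Fin (d + 1) => ω.eigenV j)
      fun j => (ω.eigenV j).subtypeₗᵢ := by
    intro i j hij f g
    rcases lt_or_gt_of_ne (Fin.val_ne_of_ne hij) with hlt | hlt
    · exact h.inner_eigenV_eq_zero hlt (Nat.le_of_lt_succ j.2) f.2 g.2
    · exact (real_inner_comm _ _).trans
        (h.inner_eigenV_eq_zero hlt (Nat.le_of_lt_succ i.2) g.2 f.2)
  rw [horth.isInternal_iff, Submodule.orthogonal_eq_bot_iff, eq_top_iff, ← h.Lam_eq_top]
  exact h.Lam_le_iSup_eigenV le_rfl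

/-- Apply the triangular formula under the sum that defines U^{j+1} and exchange summations: the
ι(u) over a fixed w add up to [d-j] ι(w). -/
theorem adj_matU_succ {j : ℕ} (f : EuclideanSpace ℝ ω.Vertex) :
    (distMatrix (ω.graph d) 1).toEuclideanLin ((ω.matU (j + 1)).toEuclideanLin f) =
      dualPolarEigenvalue (Nat.card F) d t (j + 1) • (ω.matU (j + 1)).toEuclideanLin f +
        qInt (Nat.card F) (d - j) • (ω.matU j).toEuclideanLin f := by
  classical
  simp only [toEuclideanLin_matU, map_sum, map_smul, h.adj_iota_succ, smul_add,
    Finset.sum_add_distrib, Finset.smul_sum]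
  congr 1
  · exact Finset.sum_congr rfl fun u _ => smul_comm _ _ _
  · simp only [Finset.sum_filter]
    rw [Finset.sum_comm]
    refine Finset.sum_congr rfl fun w _ => ?_
    rw [smul_smul, ← real_inner_smul_left, ← h.sum_iota_ge w, sum_inner, Finset.sum_smul,
      Finset.sum_filter]

theorem exists_matU_eigenV {i j : ℕ} (hi : i ≤ d) (hj : j ≤ d) :
    ∃ μ : ℝ, ∀ f ∈ ω.eigenV i, (ω.matU j).toEuclideanLin f = μ • f := by
  induction hj using Nat.decreasingInduction with
  | self =>
    refine ⟨1, fun f _ => ?_⟩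
    rw [h.matU_self, Matrix.toLpLin_one, LinearMap.id_apply, one_smul]
  | of_succ j hj ih =>
    obtain ⟨μ, hμ⟩ := ih
    have h1 := (qInt_pos (Finite.one_lt_card (α := F)) (Nat.sub_pos_of_lt hj)).ne'
    -- The recursion solved for U^j; the division is allowed because [d-j] ≠ 0 for j < d.
    refine ⟨(qInt (Nat.card F) (d - j))⁻¹ * (μ * (dualPolarEigenvalue (Nat.card F) d t i -
      dualPolarEigenvalue (Nat.card F) d t (j + 1))), fun f hf => ?_⟩
    have h2 := h.adj_matU_succ (j := j) f
    rw [hμ f hf, map_smul, h.adj_eigenV hi hf] at h2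
    rw [mul_smul, eq_inv_smul_iff₀ h1, eq_sub_of_add_eq' h2.symm]
    module

theorem matU_eq_sum {j : ℕ} :
    ω.matU j = ∑ l ∈ Finset.Icc j d,
      gaussBinom (Nat.card F) l j • distMatrix (ω.graph d) (d - l) := by
  ext x y
  have h1 := h.dist_add_finrank_inf x y
  rw [h.matU_apply, Matrix.sum_apply]
  have h2 : ∀ l ∈ Finset.Icc j d,
      (gaussBinom (Nat.card F) l j • distMatrix (ω.graph d) (d - l)) x y =
        if finrank F (x.1 ⊓ y.1 : Submodule F V) = l then gaussBinom (Nat.card F) l j else 0 := by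
    intro l hl
    rw [Finset.mem_Icc] at hl
    rw [Matrix.smul_apply, distMatrix, Matrix.of_apply, smul_eq_mul, mul_ite, mul_one, mul_zero]
    exact if_congr (by omega) rfl rfl
  rw [Finset.sum_congr rfl h2, Finset.sum_ite_eq]
  split_ifs with h3
  · rfl
  · exact gaussBinom_eq_zero_of_lt (by rw [Finset.mem_Icc] at h3; omega)

/-- In U^{d-i} the matrix A_i has coefficient 1 and the remaining terms are A_k with k < i, so the
scalars follow by induction on i. -/
theorem exists_distMatrix_eigenV {i j : ℕ} (hi : i ≤ d) (hj : j ≤ d) :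
    ∃ μ : ℝ, ∀ f ∈ ω.eigenV j, (distMatrix (ω.graph d) i).toEuclideanLin f = μ • f := by
  have hq : 1 < Nat.card F := Finite.one_lt_card
  induction i using Nat.strong_induction_on with
  | _ i ih =>
    obtain ⟨μ, hμ⟩ := h.exists_matU_eigenV hj (Nat.sub_le d i)
    have h1 : ∀ l : ℕ, ∃ ν : ℝ, l ∈ Finset.Ioc (d - i) d → ∀ f ∈ ω.eigenV j,
        (distMatrix (ω.graph d) (d - l)).toEuclideanLin f = ν • f := by
      intro l
      by_cases hl : l ∈ Finset.Ioc (d - i) d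
      · rw [Finset.mem_Ioc] at hl
        obtain ⟨ν, hν⟩ := ih (d - l) (by omega) (by omega)
        exact ⟨ν, fun _ => hν⟩
      · exact ⟨0, fun h => (hl h).elim⟩
    choose ν hν using h1
    refine ⟨μ - ∑ l ∈ Finset.Ioc (d - i) d, gaussBinom (Nat.card F) l (d - i) * ν l,
      fun f hf => ?_⟩
    have h2 := hμ f hf
    rw [h.matU_eq_sum, ← Finset.Ioc_insert_left (Nat.sub_le d i),
      Finset.sum_insert Finset.left_notMem_Ioc, gaussBinom_self hq, one_smul,
      Nat.sub_sub_self hi, map_add, map_sum, LinearMap.add_apply, LinearMap.sum_apply] at h2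
    rw [sub_smul, Finset.sum_smul, ← h2, eq_sub_iff_add_eq]
    congr 1
    refine Finset.sum_congr rfl fun l hl => ?_
    rw [map_smul, LinearMap.smul_apply, hν l hl f hf, mul_smul]

/-- Subtracting the eigenvalue of the top layer from A_1 sends Λ_j to Λ_{j-1} and lowers by one the
value of dim(x ∩ u) at which the function first becomes nonzero, keeping it positive there. In Λ_0,
where A_1 is a scalar, this contradicts the vanishing of f at a vertex disjoint from u. -/
theorem notMem_Lam_of_pos {u : Submodule F V} (hu : ω.IsIsotropic u) {j : ℕ}
    (hj : j < finrank F u) {f : EuclideanSpace ℝ ω.Vertex}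
    (h0 : ∀ x : ω.Vertex, finrank F (x.1 ⊓ u : Submodule F V) ≤ j → f x = 0)
    (h1 : ∀ x : ω.Vertex, finrank F (x.1 ⊓ u : Submodule F V) = j + 1 → 0 < f x) :
    f ∉ ω.Lam j := by
  classical
  have hpos : ∀ {j : ℕ} {f : EuclideanSpace ℝ ω.Vertex}, j < finrank F u →
      (∀ x : ω.Vertex, finrank F (x.1 ⊓ u : Submodule F V) ≤ j → f x = 0) →
      (∀ x : ω.Vertex, finrank F (x.1 ⊓ u : Submodule F V) = j + 1 → 0 < f x) →
      ∀ x : ω.Vertex, finrank F (x.1 ⊓ u : Submodule F V) = j →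
        0 < (distMatrix (ω.graph d) 1).toEuclideanLin f x := by
    intro j f hj h0 h1 x hx
    rw [toEuclideanLin_distMatrix_one_apply]
    have hnn : ∀ y, (ω.graph d).Adj x y → finrank F (y.1 ⊓ u : Submodule F V) ≤ j + 1 :=
      fun y hy => hx ▸ h.finrank_inf_le hy u
    obtain ⟨y, hy, hxy⟩ := h.exists_adj x hu fun h2 => by
      rw [inf_eq_right.2 h2] at hx
      omega
    refine Finset.sum_pos' (fun y hy => ?_) ⟨y, by simpa using hy, h1 y ?_⟩
    · rcases (hnn y (by simpa using hy)).eq_or_lt with h2 | h2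
      · exact (h1 y h2).le
      · exact (h0 y (Nat.le_of_lt_succ h2)).ge
    · have := hnn y hy
      omega
  induction j generalizing f with
  | zero =>
    intro hf
    obtain ⟨x, hx⟩ := h.exists_disjoint hu
    have hx0 : finrank F (x.1 ⊓ u : Submodule F V) = 0 := by rw [hx, finrank_bot]
    have h2 := hpos hj h0 h1 x hx0
    rw [h.adj_Lam_zero hf, PiLp.smul_apply, h0 x hx0.le, smul_zero] at h2
    exact h2.false
  | succ j ih =>
    intro hf
    refine ih (by omega) (fun x hx => ?_) (fun x hx => ?_) (h.adj_Lam_succ hf)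
    · rw [PiLp.sub_apply, PiLp.smul_apply, h0 x (by omega), smul_zero, sub_zero,
        toEuclideanLin_distMatrix_one_apply]
      refine Finset.sum_eq_zero fun y hy => h0 y ?_
      have := h.finrank_inf_le (by simpa using hy : (ω.graph d).Adj x y) u
      omega
    · rw [PiLp.sub_apply, PiLp.smul_apply, h0 x hx.le, smul_zero, sub_zero]
      exact hpos hj h0 h1 x hx

/-- If the projection vanished, then ι(u) with dim u = j + 1 would lie in Λ_j. But ι(u) vanishes
where dim(x ∩ u) ≤ j and equals 1 where it is j + 1. -/
theorem check_ne_zero {j : ℕ} (u : ω.Isotropic j) :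
    (ω.check j u : EuclideanSpace ℝ ω.Vertex) ≠ 0 := by
  intro h0
  have horth : ω.iota u.1 ∈ (ω.eigenV j)ᗮ :=
    Submodule.orthogonalProjectionOnto_eq_zero_iff.1 (Subtype.ext h0)
  cases j with
  | zero =>
    have h1 : ω.iota u.1 = 0 := (inner_self_eq_zero (𝕜 := ℝ)).1
      ((Submodule.mem_orthogonal _ _).1 horth _ (iota_mem_Lam u))
    obtain ⟨x, hx⟩ := h.exists_vertex_ge u.2.1
    have h2 : ω.iota u.1 x = 0 := by rw [h1]; rfl
    rw [iota_apply, if_pos hx] at h2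
    exact one_ne_zero h2
  | succ j =>
    have hjd : j < d := by
      have h1 := h.finrank_le u.2.1
      rw [u.2.2] at h1
      omega
    have h1 := iota_mem_Lam u
    rw [← Submodule.sup_orthogonal_inf_of_hasOrthogonalProjection (h.Lam_le_succ hjd),
      inf_comm] at h1
    obtain ⟨a, ha, b, hb, hab⟩ := Submodule.mem_sup.1 h1
    have hb0 : b = 0 := by
      refine (inner_self_eq_zero (𝕜 := ℝ)).1 ?_
      -- The component b equals ι(u) - a and is orthogonal to both terms.
      nth_rw 2 [eq_sub_of_add_eq' hab]
      rw [inner_sub_right, (Submodule.mem_orthogonal _ _).1 horth b hb, real_inner_comm,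
        (Submodule.mem_orthogonal _ _).1 hb.2 a ha, sub_zero]
    rw [hb0, add_zero] at hab
    refine h.notMem_Lam_of_pos u.2.1 (j := j) (by rw [u.2.2]; omega) (fun x hx => ?_)
      (fun x hx => ?_) (hab ▸ ha)
    · rw [iota_apply, if_neg]
      intro hux
      rw [inf_eq_right.2 hux, u.2.2] at hx
      omega
    · rw [iota_apply, if_pos]
      · exact one_pos
      · exact inf_eq_right.1 (Submodule.eq_of_le_of_finrank_eq inf_le_right (hx.trans u.2.2.symm))

theorem eigenV_ne_bot {j : ℕ} (hj : j ≤ d) : ω.eigenV j ≠ ⊥ := by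
  obtain ⟨u⟩ := h.nonempty_isotropic hj
  exact (Submodule.ne_bot_iff _).2 ⟨_, (ω.check j u).2, h.check_ne_zero u⟩

theorem exists_isEigenDecomposition (hd : 1 ≤ d) :
    ∃ p, IsEigenDecomposition (ω.graph d) d ω.eigenV p := by
  have h1 : ∀ i j : ℕ, ∃ μ : ℝ, i ≤ d → j ≤ d → ∀ f ∈ ω.eigenV j,
      (distMatrix (ω.graph d) i).toEuclideanLin f = μ • f := by
    intro i j
    by_cases hij : i ≤ d ∧ j ≤ d
    · obtain ⟨μ, hμ⟩ := h.exists_distMatrix_eigenV hij.1 hij.2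
      exact ⟨μ, fun _ _ => hμ⟩
    · exact ⟨0, fun hi hj => (hij ⟨hi, hj⟩).elim⟩
  choose p hp using h1
  have h2 : ∀ j ≤ d, p 1 j = dualPolarEigenvalue (Nat.card F) d t j := by
    intro j hj
    obtain ⟨f, hf, hf0⟩ := (Submodule.ne_bot_iff _).1 (h.eigenV_ne_bot hj)
    exact smul_left_injective ℝ hf0 ((hp 1 j hd hj f hf).symm.trans (h.adj_eigenV hj hf))
  refine ⟨p, h.isInternal_eigenV, fun j hj => h.eigenV_ne_bot hj, fun j k hjk hk => ?_,
    fun i hi j hj => hp i j hi hj⟩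
  rw [h2 k hk, h2 j (hjk.le.trans hk)]
  exact dualPolarEigenvalue_lt Finite.one_lt_card hjk

theorem matU_eigenV_eq_frameConst {p : ℕ → ℕ → ℝ}
    (hp : IsEigenDecomposition (ω.graph d) d ω.eigenV p) {j : ℕ} (hj : j ≤ d)
    {f : EuclideanSpace ℝ ω.Vertex} (hf : f ∈ ω.eigenV j) :
    (ω.matU j).toEuclideanLin f = frameConst (Nat.card F) d p j • f := by
  rw [h.matU_eq_sum, frameConst, map_sum, LinearMap.sum_apply, Finset.sum_smul]
  refine Finset.sum_congr rfl fun l _ => ?_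
  rw [map_smul, LinearMap.smul_apply, hp.apply_eq _ (Nat.sub_le d l) j hj f hf, mul_smul]

/-- For nonzero f in V_j, λ_j ‖f‖² is the sum of the ⟨f, ι(u)⟩². These do not all vanish, since f
lies in the span of the ι(u). -/
theorem frameConst_pos {p : ℕ → ℕ → ℝ}
    (hp : IsEigenDecomposition (ω.graph d) d ω.eigenV p) {j : ℕ} (hj : j ≤ d) :
    0 < frameConst (Nat.card F) d p j := by
  obtain ⟨f, hf, hf0⟩ := (Submodule.ne_bot_iff _).1 (h.eigenV_ne_bot hj)
  have h1 := inner_matU j f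
  rw [h.matU_eigenV_eq_frameConst hp hj hf, real_inner_smul_right] at h1
  have h2 : 0 < ∑ u : ω.Isotropic j, inner ℝ f (ω.iota u.1) ^ 2 := by
    refine lt_of_le_of_ne (Finset.sum_nonneg fun _ _ => sq_nonneg _) fun h3 =>
      hf0 (eq_zero_of_mem_eigenV hf fun u => ?_)
    exact pow_eq_zero_iff two_ne_zero |>.1
      ((Finset.sum_eq_zero_iff_of_nonneg fun _ _ => sq_nonneg _).1 h3.symm u (Finset.mem_univ u))
  rw [← h1] at h2
  exact pos_of_mul_pos_left h2 real_inner_self_nonneg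

end IsRegular

omit [Finite F] [FiniteDimensional F V] in
theorem inner_check {j : ℕ} (f : ω.eigenV j) (u : ω.Isotropic j) :
    inner ℝ f (ω.check j u) = inner ℝ (f : EuclideanSpace ℝ ω.Vertex) (ω.iota u.1) :=
  Submodule.inner_orthogonalProjectionOnto_eq_of_mem_left f _

end PolarForm

theorem mainTheorem2 {F V : Type*} [Field F] [Finite F] [AddCommGroup V] [Module F V] [Finite V]
    (d : ℕ) (hd : 2 ≤ d) (ω : PolarForm F V) (hω : ω.IsDualPolar d) :
    ∃ p : ℕ → ℕ → ℝ, IsEigenDecomposition (ω.graph d) d ω.eigenV p ∧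
      ∀ j ≤ d,
        ω.matU j = ∑ l ∈ Finset.Icc j d,
          gaussBinom (Nat.card F) l j • distMatrix (ω.graph d) (d - l) ∧
        (∀ f ∈ ω.eigenV j,
          (ω.matU j).toEuclideanLin f = frameConst (Nat.card F) d p j • f) ∧
        (∀ u : ω.Isotropic j, Module.End.HasEigenvector (ω.matU j).toEuclideanLin
          (frameConst (Nat.card F) d p j) (ω.check j u : EuclideanSpace ℝ ω.Vertex)) ∧
        0 < frameConst (Nat.card F) d p j ∧
        IsTightFrame (ω.check j) (frameConst (Nat.card F) d p j) ∧
        ∀ f : ω.eigenV j,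
          ∑ u : ω.Isotropic j, inner ℝ (ω.check j u) f • ω.check j u =
            frameConst (Nat.card F) d p j • f := by
  obtain ⟨t, h⟩ := hω.exists_isRegular
  obtain ⟨p, hp⟩ := h.exists_isEigenDecomposition (by omega)
  refine ⟨p, hp, fun j hj => ?_⟩
  have hU := fun f (hf : f ∈ ω.eigenV j) => h.matU_eigenV_eq_frameConst hp hj hf
  have hpos := h.frameConst_pos hp hj
  refine ⟨h.matU_eq_sum, hU, fun u => ⟨?_, h.check_ne_zero u⟩, hpos, ⟨hpos.ne', fun f => ?_⟩,
    fun f => ?_⟩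
  · exact Module.End.mem_eigenspace_iff.2 (hU _ (ω.check j u).2)
  · have h1 := PolarForm.inner_matU j (f : EuclideanSpace ℝ ω.Vertex)
    rw [hU _ f.2, real_inner_smul_right, real_inner_self_eq_norm_sq] at h1
    rw [Submodule.coe_norm, h1]
    exact Finset.sum_congr rfl fun u _ => by rw [sq_abs, PolarForm.inner_check]
  -- The reconstruction formula is the orthogonal projection onto V_j of U^j f = λ_j f, with U^j f
  -- expanded in the ι(u).
  · have h1 := congrArg (ω.eigenV j).orthogonalProjectionOnto (hU _ f.2)
    rw [PolarForm.toEuclideanLin_matU, map_sum, map_smul,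
      Submodule.orthogonalProjectionOnto_mem_subspace_eq_self] at h1
    rw [← h1]
    exact Finset.sum_congr rfl fun u _ => by
      rw [map_smul, real_inner_comm, PolarForm.inner_check, real_inner_comm]; rfl
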